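/- Let $d\ge 2$ and let $\Omega_f,\Omega_s\subset\mathbb R^d$ be disjoint bounded Lipschitz domains with outward normals $n,n_s$. Put $\Sigma=\partial\Omega_f\cap\partial\Omega_s$ and $\Sigma_i=\partial\Omega_i\setminus\Sigma$ ($i=f,s$). Let $\rho_f,\rho_s,\mu,L_1,\lambda>0$, $L_2\ge 0$, and let $T=N\Delta t$ with an integer $N\ge 1$ and $\Delta t>0$; put $t_n=n\Delta t$. For a fluid velocity $v$ and pressure $q$ write $\sigma=2\mu\varepsilon(v)-qI$, and for a solid displacement $\xi$ write $\sigma=2L_1\varepsilon(\xi)+L_2(\operatorname{div}\xi)I$, where $\varepsilon$ is the symmetric gradient; let $\|\xi\|_S^2=2L_1\|\varepsilon(\xi)\|_{L^2(\Omega_s)}^2+L_2\|\operatorname{div}\xi\|_{L^2(\Omega_s)}^2$. Exact problem. Let $(\mathcal U,\mathcal P,\mathcal E)$, with stresses $\sigma_{\mathcal F},\sigma_{\mathcal S}$, solve on $(0,T)$: $\rho_f\partial_t\mathcal U-\operatorname{div}\sigma_{\mathcal F}=0$ and $\operatorname{div}\mathcal U=0$ in $\Omega_f$, $\mathcal U=0$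 on $\Sigma_f$; $\rho_s\partial_{tt}\mathcal E-\operatorname{div}\sigma_{\mathcal S}=0$ in $\Omega_s$, $\mathcal E=0$ on $\Sigma_s$; $\mathcal U=\partial_t\mathcal E$ and $\sigma_{\mathcal S}n_s+\sigma_{\mathcal F}n=0$ on $\Sigma$. Splitting method. Set $\eta^0(t_0)=\mathcal E(t_0)$, $\dot\eta^0(t_0)=\partial_t\mathcal E(t_0)$, $u^0(t_0)=\mathcal U(t_0)$. For $n=0,\dots,N-1$ let $\eta^{n+1}$, $\dot\eta^{n+1}=\partial_t\eta^{n+1}$, with stress $\sigma_s^{n+1}$, and then $(u^{n+1},p^{n+1})$, with stress $\sigma_f^{n+1}$, solve on $[t_n,t_{n+1}]$ $$\rho_s\partial_t\dot\eta^{n+1}-\operatorname{div}\sigma_s^{n+1}=0\ \text{in }\Omega_s,\quad \eta^{n+1}=0\ \text{on }\Sigma_s,\quad \lambda\dot\eta^{n+1}+\sigma_s^{n+1}n_s=\lambda\tilde u^n-\tilde\sigma_f^n n\ \text{on }\Sigma,$$ $$\rho_f\partial_t u^{n+1}-\operatorname{div}\sigma_f^{n+1}=0,\ \operatorname{div}u^{n+1}=0\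 \text{in }\Omega_f,\quad u^{n+1}=0\ \text{on }\Sigma_f,\quad \lambda u^{n+1}+\sigma_f^{n+1}n=\lambda\dot\eta^{n+1}+\tilde\sigma_f^n n\ \text{on }\Sigma,$$ with $\eta^{n+1}(t_n)=\eta^n(t_n)$, $\dot\eta^{n+1}(t_n)=\dot\eta^n(t_n)$, $u^{n+1}(t_n)=u^n(t_n)$, where for $n\ge 1$ a tilde denotes the average $\tilde w^n=\frac1{\Delta t}\int_{t_{n-1}}^{t_n}w^n(s)\,ds$, and $\tilde u^0=\mathcal U(t_0)$, $\tilde\sigma_f^0=\sigma_{\mathcal F}(t_0)$. All solutions are weak (finite energy) solutions: velocities are continuous in time with values in $L^2$, fluid velocities are $L^2$ in time with values in $H^1$, displacements are continuous in time with values in $H^1$, pressures are integrable in time with values in $L^2(\Omega_f)$; and on each time interval the normal stresses (in the sense of Green's formula) and the velocities on $\Sigma$ (for the solid, the time derivative of the trace of the displacement) are in $L^2$ in time with values in $L^2(\Sigma)$. Assume moreover $\partial_t\mathcal U,\ \partial_t\sigma_{\mathcal F}n\in L^2(0,T;L^2(\Sigma))$. Put $e_u^n=\mathcal U-u^n$,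 $e_f^n=\sigma_{\mathcal F}-\sigma_f^n$, $e_\eta^n=\mathcal E-\eta^n$, $\dot e_\eta^n=\partial_t\mathcal E-\dot\eta^n$ on $[t_{n-1},t_n]$, $\tilde e_u^0=0$, and $$\mathbb E^n=\tfrac{\rho_f}2\|e_u^n(t_n)\|_{L^2(\Omega_f)}^2+\tfrac{\rho_s}2\|\dot e_\eta^n(t_n)\|_{L^2(\Omega_s)}^2+\tfrac12\|e_\eta^n(t_n)\|_S^2,$$ $$\mathbb T^n=2\mu\int_{t_{n-1}}^{t_n}\|\varepsilon(e_u^n)\|_{L^2(\Omega_f)}^2ds+\tfrac\lambda4\int_{t_{n-1}}^{t_n}\|\dot e_\eta^n-\tilde e_u^{n-1}\|_{L^2(\Sigma)}^2ds,$$ $$\mathbb S^n=\tfrac1{2\lambda}\int_{t_{n-1}}^{t_n}\|e_f^n n\|_{L^2(\Sigma)}^2ds+\tfrac\lambda2\int_{t_{n-1}}^{t_n}\|e_u^n\|_{L^2(\Sigma)}^2ds .$$ Then $$\mathbb E^N+\sum_{n=1}^N\mathbb T^n+\mathbb S^N\le C\,\Delta t\,T\Big(\lambda\|\partial_t\mathcal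 U\|_{L^2(0,T;L^2(\Sigma))}^2+\tfrac1\lambda\|\partial_t\sigma_{\mathcal F}n\|_{L^2(0,T;L^2(\Sigma))}^2\Big)$$ with an absolute constant $C$; in particular $C$ does not depend on $T$, $\Delta t$, $N$, $\lambda$, the other parameters, the domains or the solutions. -/

import Mathlib

open MeasureTheory Set Filter Topology
open scoped ContDiff

noncomputable section

/-! ## Vector and tensor fields, surface measure, Lipschitz domains -/

/-- Points and vectors of `ℝ^d`. -/
abbrev Vec (d : ℕ) := EuclideanSpace ℝ (Fin d)

/-- Tensors (`d × d` matrices) with the Frobenius norm and inner product. -/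
abbrev Ten (d : ℕ) := EuclideanSpace ℝ (Fin d × Fin d)

/-- The surface measure of `ℝ^d`: the `(d-1)`-dimensional Hausdorff measure, normalized so as to
agree with Lebesgue measure on hyperplanes. -/
def surfaceMeasure (d : ℕ) : Measure (Vec d) := Measure.euclideanHausdorffMeasure (d - 1)

/-- `L²(Ω; F)` for a set `Ω` of `ℝ^d`, with respect to Lebesgue measure. -/
abbrev L2Vol {d : ℕ} (Ω : Set (Vec d)) (F : Type) [NormedAddCommGroup F] :=
  Lp F 2 ((volume : Measure (Vec d)).restrict Ω)

/-- `L²(Γ; ℝ^d)` for a piece `Γ` of a hypersurface of `ℝ^d`, with respect to surface measure. -/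
abbrev L2Surf {d : ℕ} (Γ : Set (Vec d)) :=
  Lp (Vec d) 2 ((surfaceMeasure d).restrict Γ)

/-- `Ω` is a bounded open set with Lipschitz boundary: near each boundary point, `Ω` is the part
of space that lies strictly above the graph of a Lipschitz function, in some direction `e`.
(The function `g` is constant along `e`, so it is a function on the hyperplane `e^⊥`.) -/
structure IsLipschitzDomain {d : ℕ} (Ω : Set (Vec d)) : Prop where
  isOpen : IsOpen Ω
  isBounded : Bornology.IsBounded Ω
  lipschitz_boundary : ∀ x ∈ frontier Ω, ∃ (r : ℝ) (e : Vec d) (g : Vec d → ℝ) (K : NNReal),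
    0 < r ∧ ‖e‖ = 1 ∧ LipschitzWith K g ∧ (∀ (y : Vec d) (t : ℝ), g (y + t • e) = g y) ∧
      Ω ∩ Metric.ball x r = {y | g y < inner ℝ e y} ∩ Metric.ball x r

/-- The interface of two domains, the common part of their boundaries. -/
def interface {d : ℕ} (Ω₁ Ω₂ : Set (Vec d)) : Set (Vec d) := frontier Ω₁ ∩ frontier Ω₂

/-! ## The Sobolev space `H¹(Ω)^d`, its traces, and `ε`, `div`, stress tensors -/

/-- The gradient tensor of a differentiable field, with entries `∂_j φ_i`. -/
def gradTen {d : ℕ} (φ : Vec d → Vec d) (x : Vec d) : Ten d :=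
  WithLp.toLp 2 fun ij => fderiv ℝ φ x (EuclideanSpace.single ij.2 1) ij.1

/-- The triples `(v, ∇v, v|_Γ)` with `v ∈ H¹(Ω)^d`, where `Γ` is a part of the boundary of `Ω`:
the closure, in `L²(Ω) × L²(Ω) × L²(Γ)`, of the triples `(φ, ∇φ, φ|_Γ)` with `φ` smooth up to
the boundary. On a Lipschitz domain, where such fields are dense in `H¹(Ω)^d` and the trace operator
is the continuous extension of the restriction to the boundary, this is exactly the graph of
(weak gradient, trace) over `H¹(Ω)^d`. -/
def sobolevGraph {d : ℕ} (Ω Γ : Set (Vec d)) :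
    Submodule ℝ (L2Vol Ω (Vec d) × L2Vol Ω (Ten d) × L2Surf Γ) :=
  (Submodule.span ℝ {z | ∃ φ : Vec d → Vec d, ContDiff ℝ ∞ φ ∧ HasCompactSupport φ ∧
    (z.1 : Vec d → Vec d) =ᵐ[volume.restrict Ω] φ ∧
    (z.2.1 : Vec d → Ten d) =ᵐ[volume.restrict Ω] gradTen φ ∧
    (z.2.2 : Vec d → Vec d) =ᵐ[(surfaceMeasure d).restrict Γ] φ}).topologicalClosure

/-- The triples `(v, ∇v, v|_Γ)` with `v ∈ H¹(Ω)^d` and `v = 0` on `∂Ω \ Γ`. -/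
def energySpace {d : ℕ} (Ω Γ : Set (Vec d)) :
    Set (L2Vol Ω (Vec d) × L2Vol Ω (Ten d) × L2Surf Γ) :=
  {z | z ∈ sobolevGraph Ω Γ ∧ (z.1, z.2.1, 0) ∈ sobolevGraph Ω (frontier Ω \ Γ)}

/-- The symmetric part of a tensor. -/
def symPart (d : ℕ) : Ten d →L[ℝ] Ten d :=
  LinearMap.toContinuousLinearMap
    { toFun := fun A => WithLp.toLp 2 fun ij => (A (ij.1, ij.2) + A (ij.2, ij.1)) / 2
      map_add' := fun A B => by ext ij; simp; ring
      map_smul' := fun c A => by ext ij; simp; ring }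

/-- The trace (sum of the diagonal entries) of a tensor. -/
def tenTrace (d : ℕ) : Ten d →L[ℝ] ℝ :=
  LinearMap.toContinuousLinearMap
    { toFun := fun A => ∑ i, A (i, i)
      map_add' := fun A B => by simp [Finset.sum_add_distrib]
      map_smul' := fun c A => by simp [Finset.mul_sum] }

/-- The multiples `q ↦ q I` of the identity tensor. -/
def scalarTen (d : ℕ) : ℝ →L[ℝ] Ten d :=
  LinearMap.toContinuousLinearMap
    { toFun := fun q => WithLp.toLp 2 fun ij => if ij.1 = ij.2 then q else 0
      map_add' := fun p q => by ext ij; by_cases h : ij.1 = ij.2 <;> simp [h]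
      map_smul' := fun c q => by ext ij; by_cases h : ij.1 = ij.2 <;> simp [h] }

/-- The symmetric gradient `ε(v)`, as a function of the gradient `G = ∇v`. -/
def symGrad {d : ℕ} {Ω : Set (Vec d)} (G : L2Vol Ω (Ten d)) : L2Vol Ω (Ten d) :=
  (symPart d).compLp G

/-- The divergence `div v`, as a function of the gradient `G = ∇v`. -/
def divg {d : ℕ} {Ω : Set (Vec d)} (G : L2Vol Ω (Ten d)) : L2Vol Ω ℝ :=
  (tenTrace d).compLp G

/-- The fluid stress tensor `2 μ ε(u) - p I`, where `G = ∇u`. -/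
def fluidStress {d : ℕ} {Ω : Set (Vec d)} (μ : ℝ) (G : L2Vol Ω (Ten d)) (p : L2Vol Ω ℝ) :
    L2Vol Ω (Ten d) :=
  (2 * μ) • symGrad G - (scalarTen d).compLp p

/-- The solid stress tensor `2 L₁ ε(η) + L₂ (div η) I`, where `G = ∇η`. -/
def solidStress {d : ℕ} {Ω : Set (Vec d)} (L₁ L₂ : ℝ) (G : L2Vol Ω (Ten d)) :
    L2Vol Ω (Ten d) :=
  (2 * L₁) • symGrad G + L₂ • (scalarTen d).compLp (divg G)

/-- The square of the elastic energy norm,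
`‖η‖_S² = 2 L₁ ‖ε(η)‖² + L₂ ‖div η‖²`, where `G = ∇η`. -/
def elasticNormSq {d : ℕ} {Ω : Set (Vec d)} (L₁ L₂ : ℝ) (G : L2Vol Ω (Ten d)) : ℝ :=
  2 * L₁ * ‖symGrad G‖ ^ 2 + L₂ * ‖divg G‖ ^ 2

/-! ## Functions of time with values in a Hilbert space -/

/-- `f ∈ L²(a, b; X)`. -/
def L2Time {X : Type} [NormedAddCommGroup X] (a b : ℝ) (f : ℝ → X) : Prop :=
  MemLp f 2 ((volume : Measure ℝ).restrict (Icc a b))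

/-- `f` is absolutely continuous on `[a, b]` with time derivative `f' ∈ L¹(a, b; X)`. -/
def HasTimeDeriv {X : Type} [NormedAddCommGroup X] [NormedSpace ℝ X] (a b : ℝ) (f f' : ℝ → X) :
    Prop :=
  IntegrableOn f' (Icc a b) ∧ ∀ t ∈ Icc a b, f t = f a + ∫ τ in a..t, f' τ

/-! ## The fluid problem -/

/-- The unknowns of a Stokes problem in `Ω`, as functions of time: the velocity `u`, its gradient,
its values on the interface `Γ`, the pressure, and the normal stress `σ n` on `Γ`. -/
structure FluidHistory {d : ℕ} (Ω Γ : Set (Vec d)) where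
  vel : ℝ → L2Vol Ω (Vec d)
  grad : ℝ → L2Vol Ω (Ten d)
  velTrace : ℝ → L2Surf Γ
  pressure : ℝ → L2Vol Ω ℝ
  normalStress : ℝ → L2Surf Γ

/-- `w` solves the Stokes equations `ρ ∂_t u - div σ = 0`, `σ = 2 μ ε(u) - p I`, `div u = 0` in
`Ω × [a, b]` with `u = 0` on `∂Ω \ Γ`, in the sense of weak (finite energy) solutions, and
`w.normalStress` is its normal stress `σ n` on `Γ` (`n` the outward normal).
The last field is the first equation tested with a field `v ∈ H¹(Ω)^d` with `v = 0` on `∂Ω \ Γ`,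
integrated by parts in space and integrated over `[a, t]`; for `v` compactly supported in `Ω` it is
the equation, and the boundary term over `Γ` is the definition of the normal stress by Green's
formula. -/
structure IsFluidSolution {d : ℕ} {Ω Γ : Set (Vec d)} (ρ μ : ℝ) (a b : ℝ)
    (w : FluidHistory Ω Γ) : Prop where
  vel_continuous : ContinuousOn w.vel (Icc a b)
  mem_energySpace : ∀ᵐ t ∂((volume : Measure ℝ).restrict (Icc a b)),
    (w.vel t, w.grad t, w.velTrace t) ∈ energySpace Ω Γ
  grad_L2 : L2Time a b w.grad
  velTrace_L2 : L2Time a b w.velTrace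
  pressure_integrable : IntegrableOn w.pressure (Icc a b)
  normalStress_L2 : L2Time a b w.normalStress
  div_eq_zero : ∀ᵐ t ∂((volume : Measure ℝ).restrict (Icc a b)), divg (w.grad t) = 0
  momentum : ∀ v ∈ energySpace Ω Γ, ∀ t ∈ Icc a b,
    ρ * inner ℝ (w.vel t - w.vel a) v.1 =
      ∫ τ in a..t, (inner ℝ (w.normalStress τ) v.2.2
        - inner ℝ (fluidStress μ (w.grad τ) (w.pressure τ)) v.2.1)

/-! ## The solid problem -/

/-- The unknowns of a linear elasticity problem in `Ω`, as functions of time: the displacement `η`,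
its gradient, its values on the interface `Γ`, the velocity `∂_t η`, its values on `Γ`, and the
normal stress `σ n` on `Γ`. -/
structure SolidHistory {d : ℕ} (Ω Γ : Set (Vec d)) where
  disp : ℝ → L2Vol Ω (Vec d)
  grad : ℝ → L2Vol Ω (Ten d)
  dispTrace : ℝ → L2Surf Γ
  vel : ℝ → L2Vol Ω (Vec d)
  velTrace : ℝ → L2Surf Γ
  normalStress : ℝ → L2Surf Γ

/-- `w` solves the elasticity equations `ρ ∂_tt η - div σ = 0`,
`σ = 2 L₁ ε(η) + L₂ (div η) I` in `Ω × [a, b]` with `η = 0` on `∂Ω \ Γ`, in the sense of weak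
(finite energy) solutions: `η` is continuous in time with values in `H¹(Ω)^d`, and `∂_t η` with
values in `L²(Ω)^d`. On `Γ`, `w.velTrace` is the time derivative of the trace of `η`, and
`w.normalStress` is the normal stress `σ n` (`n` the outward normal), defined by Green's formula
in the last field as for the fluid. -/
structure IsSolidSolution {d : ℕ} {Ω Γ : Set (Vec d)} (ρ L₁ L₂ : ℝ) (a b : ℝ)
    (w : SolidHistory Ω Γ) : Prop where
  mem_energySpace : ∀ t ∈ Icc a b, (w.disp t, w.grad t, w.dispTrace t) ∈ energySpace Ω Γ
  disp_continuous : ContinuousOn (fun t => (w.disp t, w.grad t)) (Icc a b)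
  vel_continuous : ContinuousOn w.vel (Icc a b)
  disp_deriv : HasTimeDeriv a b w.disp w.vel
  velTrace_L2 : L2Time a b w.velTrace
  dispTrace_deriv : HasTimeDeriv a b w.dispTrace w.velTrace
  normalStress_L2 : L2Time a b w.normalStress
  momentum : ∀ v ∈ energySpace Ω Γ, ∀ t ∈ Icc a b,
    ρ * inner ℝ (w.vel t - w.vel a) v.1 =
      ∫ τ in a..t, (inner ℝ (w.normalStress τ) v.2.2
        - inner ℝ (solidStress L₁ L₂ (w.grad τ)) v.2.1)

/-! ## The coupled problem and the Robin-Robin splitting method -/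

/-- `U` (fluid) and `S` (solid) solve the coupled problem on `[0, T]`: the Stokes equations, the
elasticity equations, and on the interface `u = ∂_t η` and `σ_s n_s + σ_f n = 0`. -/
structure IsCoupledSolution {d : ℕ} {Ωf Ωs Γ : Set (Vec d)} (ρf ρs μ L₁ L₂ : ℝ) (T : ℝ)
    (U : FluidHistory Ωf Γ) (S : SolidHistory Ωs Γ) : Prop where
  fluid : IsFluidSolution ρf μ 0 T U
  solid : IsSolidSolution ρs L₁ L₂ 0 T S
  velocity : ∀ᵐ t ∂((volume : Measure ℝ).restrict (Icc 0 T)), U.velTrace t = S.velTrace t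
  stress : ∀ᵐ t ∂((volume : Measure ℝ).restrict (Icc 0 T)),
    S.normalStress t + U.normalStress t = 0

/-- The time averages `x̃ⁿ = Δt⁻¹ ∫_{t_{n-1}}^{t_n} xⁿ(s) ds` for `n ≥ 1`, `t_n = n Δt`, and
`x̃⁰ = x₀`. -/
def lagged {X : Type} [NormedAddCommGroup X] [NormedSpace ℝ X] (Δt : ℝ) (x₀ : X)
    (x : ℕ → ℝ → X) : ℕ → X
  | 0 => x₀
  | n + 1 => Δt⁻¹ • ∫ s in (n * Δt : ℝ)..((n + 1 : ℕ) * Δt : ℝ), x (n + 1) s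

/-- `u n`, `η n` (`1 ≤ n ≤ N`) are the solutions on `[t_{n-1}, t_n]` produced by `N` steps of the
splitting method with Robin parameter `lam`, started from the exact solution `U`, `S` at time `0`
(`u 0` and `η 0` play no role). -/
structure IsSplittingSolution {d : ℕ} {Ωf Ωs Γ : Set (Vec d)} (ρf ρs μ L₁ L₂ lam Δt : ℝ) (N : ℕ)
    (U : FluidHistory Ωf Γ) (S : SolidHistory Ωs Γ)
    (u : ℕ → FluidHistory Ωf Γ) (η : ℕ → SolidHistory Ωs Γ) : Prop where
  solid : ∀ n < N, IsSolidSolution ρs L₁ L₂ (n * Δt) ((n + 1 : ℕ) * Δt) (η (n + 1))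
  fluid : ∀ n < N, IsFluidSolution ρf μ (n * Δt) ((n + 1 : ℕ) * Δt) (u (n + 1))
  solid_robin : ∀ n < N,
    ∀ᵐ t ∂((volume : Measure ℝ).restrict (Icc (n * Δt) ((n + 1 : ℕ) * Δt))),
      lam • (η (n + 1)).velTrace t + (η (n + 1)).normalStress t =
        lam • lagged Δt (U.velTrace 0) (fun m => (u m).velTrace) n
          - lagged Δt (U.normalStress 0) (fun m => (u m).normalStress) n
  fluid_robin : ∀ n < N,
    ∀ᵐ t ∂((volume : Measure ℝ).restrict (Icc (n * Δt) ((n + 1 : ℕ) * Δt))),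
      lam • (u (n + 1)).velTrace t + (u (n + 1)).normalStress t =
        lam • (η (n + 1)).velTrace t
          + lagged Δt (U.normalStress 0) (fun m => (u m).normalStress) n
  disp_initial : 0 < N → (η 1).disp 0 = S.disp 0
  solidVel_initial : 0 < N → (η 1).vel 0 = S.vel 0
  fluidVel_initial : 0 < N → (u 1).vel 0 = U.vel 0
  disp_continue : ∀ n, 1 ≤ n → n < N → (η (n + 1)).disp (n * Δt) = (η n).disp (n * Δt)
  solidVel_continue : ∀ n, 1 ≤ n → n < N → (η (n + 1)).vel (n * Δt) = (η n).vel (n * Δt)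
  fluidVel_continue : ∀ n, 1 ≤ n → n < N → (u (n + 1)).vel (n * Δt) = (u n).vel (n * Δt)

/-! ## The error quantities -/

/-- The difference of two fluid histories, component by component. -/
instance {d : ℕ} {Ω Γ : Set (Vec d)} : Sub (FluidHistory Ω Γ) where
  sub w z :=
    { vel := w.vel - z.vel
      grad := w.grad - z.grad
      velTrace := w.velTrace - z.velTrace
      pressure := w.pressure - z.pressure
      normalStress := w.normalStress - z.normalStress }

/-- The difference of two solid histories, component by component. -/
instance {d : ℕ} {Ω Γ : Set (Vec d)} : Sub (SolidHistory Ω Γ) where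
  sub w z :=
    { disp := w.disp - z.disp
      grad := w.grad - z.grad
      dispTrace := w.dispTrace - z.dispTrace
      vel := w.vel - z.vel
      velTrace := w.velTrace - z.velTrace
      normalStress := w.normalStress - z.normalStress }

/-- The energy
`ρf/2 ‖e_u(t)‖² + ρs/2 ‖ė_η(t)‖² + 1/2 ‖e_η(t)‖_S²` of the errors `e`, `z` at time `t`. -/
def energyError {d : ℕ} {Ωf Ωs Γ : Set (Vec d)} (ρf ρs L₁ L₂ : ℝ)
    (e : FluidHistory Ωf Γ) (z : SolidHistory Ωs Γ) (t : ℝ) : ℝ :=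
  ρf / 2 * ‖e.vel t‖ ^ 2 + ρs / 2 * ‖z.vel t‖ ^ 2 + 1 / 2 * elasticNormSq L₁ L₂ (z.grad t)

/-- The dissipation
`2μ ∫_a^b ‖ε(e_u)‖² ds + lam/4 ∫_a^b ‖ė_η - ẽ‖²_{L²(Γ)} ds` of the errors `e`, `z` over `[a, b]`,
for a given lagged interface velocity error `ẽ`. -/
def dissipationError {d : ℕ} {Ωf Ωs Γ : Set (Vec d)} (μ lam a b : ℝ)
    (e : FluidHistory Ωf Γ) (z : SolidHistory Ωs Γ) (elag : L2Surf Γ) : ℝ :=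
  2 * μ * (∫ s in a..b, ‖symGrad (e.grad s)‖ ^ 2)
    + lam / 4 * ∫ s in a..b, ‖z.velTrace s - elag‖ ^ 2

/-- The interface error
`1/(2 lam) ∫_a^b ‖e_f n‖²_{L²(Γ)} ds + lam/2 ∫_a^b ‖e_u‖²_{L²(Γ)} ds`. -/
def interfaceError {d : ℕ} {Ωf Γ : Set (Vec d)} (lam a b : ℝ) (e : FluidHistory Ωf Γ) : ℝ :=
  1 / (2 * lam) * (∫ s in a..b, ‖e.normalStress s‖ ^ 2)
    + lam / 2 * ∫ s in a..b, ‖e.velTrace s‖ ^ 2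

end

/-! On each time step the errors solve the homogeneous Stokes and elasticity problems, so their
energy changes only through viscous dissipation and the power of the interface forces. Exact data
satisfy both Robin conditions without lag, because velocities agree and stresses balance on the
interface. Subtraction therefore gives Robin conditions for the errors, perturbed by the lag errors
`r`, `q` of the exact velocity and normal stress. By an algebraic identity (`robin_power_eq`) the
power is the interface energy of the lagged data minus that of the new data, minus a square, plus
terms with `r` and `q`.

Averaging does not increase the L² norm in time, so the lagged data are bounded by the interface
error of the previous step and the estimate telescopes. Young's inequality with weight κ multiplies
the old interface error by 1 + κ and the squares of the lag errors by 1 + 1/κ. The choice κ = 1/N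
keeps the total amplification (1 + 1/N)^N below 3, whatever T is. Each lag error squared is at most
2Δt times an integral of the squared time derivative over two steps (`norm_sub_lagged_sq_le`).
Weighted by 1 + N ≤ 2N, integrated over a step and summed with overlap 2, this gives 3 · 2N · 2Δt² ·
2 = 24 Δt T.

The analytic work is the energy identity for weak solutions, whose velocity has no time derivative
to test with. The momentum balance over [s, s + h] is tested with a forward time average of the
solution, which gives an exact identity; then h → 0 (`parabolic_energy`, `hyperbolic_energy`). The
pressure, only integrable in time, is removed beforehand by divergence-free test fields. Finally,
the method passes on displacements while the elastic energy contains their gradients; uniqueness of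
weak gradients (`sobolevGraph_grad_unique`) closes this gap. -/

open scoped ENNReal

/-! ## Steklov averages -/

/-- The forward Steklov average `h⁻¹ ∫_s^{s+h} f`. -/
noncomputable def steklov {E : Type} [NormedAddCommGroup E] [NormedSpace ℝ E] (h : ℝ) (f : ℝ → E)
    (s : ℝ) : E :=
  h⁻¹ • ∫ τ in s..s + h, f τ

theorem eLpNorm_two_sq {α E : Type} [MeasurableSpace α] [NormedAddCommGroup E] (μ : Measure α)
    (f : α → E) : eLpNorm f 2 μ ^ 2 = ∫⁻ x, ‖f x‖ₑ ^ 2 ∂μ := by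
  have := eLpNorm_nnreal_pow_eq_lintegral (f := f) (μ := μ) (p := 2) (by norm_num)
  calc eLpNorm f 2 μ ^ 2 = ∫⁻ x, ‖f x‖ₑ ^ (((2 : NNReal) : ℝ)) ∂μ := by
        rw [← this, ← ENNReal.rpow_natCast]; norm_num
    _ = _ := by simp only [← ENNReal.rpow_natCast]; norm_num

/-- Cauchy–Schwarz against the constant 1. In extended nonnegative reals no integrability has to be
known, which suits the use of Tonelli below. -/
theorem enorm_integral_sq_le {E : Type} [NormedAddCommGroup E] [NormedSpace ℝ E] {a b : ℝ}
    (hab : a ≤ b) {f : ℝ → E} (hf : AEStronglyMeasurable f (volume.restrict (Ioc a b))) :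
    ‖∫ x in a..b, f x‖ₑ ^ 2 ≤ ENNReal.ofReal (b - a) * ∫⁻ x in Ioc a b, ‖f x‖ₑ ^ 2 := by
  rw [intervalIntegral.integral_of_le hab]
  have h1 : ‖∫ x in Ioc a b, f x‖ₑ ≤ eLpNorm f 1 (volume.restrict (Ioc a b)) := by
    rw [eLpNorm_one_eq_lintegral_enorm]
    exact enorm_integral_le_lintegral_enorm _
  have h2 := eLpNorm_le_eLpNorm_mul_rpow_measure_univ (p := 1) (q := 2)
    (by norm_num) hf
  have h3 : (((volume.restrict (Ioc a b)) (univ : Set ℝ))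
      ^ (1 / (1 : ℝ≥0∞).toReal - 1 / (2 : ℝ≥0∞).toReal)) ^ 2 = ENNReal.ofReal (b - a) := by
    rw [Measure.restrict_apply_univ, Real.volume_Ioc, ← ENNReal.rpow_natCast, ← ENNReal.rpow_mul]
    norm_num
  calc ‖∫ x in Ioc a b, f x‖ₑ ^ 2 ≤ (eLpNorm f 2 (volume.restrict (Ioc a b)) *
        ((volume.restrict (Ioc a b)) (univ : Set ℝ))
      ^ (1 / (1 : ℝ≥0∞).toReal - 1 / (2 : ℝ≥0∞).toReal)) ^ 2 := by
        gcongr; exact h1.trans h2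
    _ = _ := by rw [mul_pow, h3, eLpNorm_two_sq, mul_comm]

theorem steklov_congr_ae {E : Type} [NormedAddCommGroup E] [NormedSpace ℝ E] {f g : ℝ → E}
    (hfg : f =ᵐ[volume] g) (h : ℝ) : steklov h f = steklov h g := by
  funext s
  unfold steklov
  congr 1
  exact intervalIntegral.integral_congr_ae (hfg.mono fun x hx _ => hx)

theorem locallyIntegrable_of_memLp_two {E : Type} [NormedAddCommGroup E] {f : ℝ → E}
    (hf : MemLp f 2) : LocallyIntegrable f :=
  hf.locallyIntegrable (by norm_num)

theorem intervalIntegrable_of_locallyIntegrable {E : Type} [NormedAddCommGroup E] {f : ℝ → E}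
    (hf : LocallyIntegrable f) (a b : ℝ) : IntervalIntegrable f volume a b :=
  (intervalIntegrable_iff' (by finiteness)).2 (hf.integrableOn_isCompact isCompact_uIcc)

theorem intervalIntegrable_of_memLp_two {E : Type} [NormedAddCommGroup E] {f : ℝ → E}
    (hf : MemLp f 2) (a b : ℝ) : IntervalIntegrable f volume a b :=
  intervalIntegrable_of_locallyIntegrable (locallyIntegrable_of_memLp_two hf) a b

theorem steklov_sub_eq {E : Type} [NormedAddCommGroup E] [NormedSpace ℝ E] [CompleteSpace E]
    {f : ℝ → E} (hf : MemLp f 2) {h : ℝ} (hh : 0 < h) (s : ℝ) :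
    steklov h f s - f s = h⁻¹ • ∫ θ in (0 : ℝ)..h, (f (s + θ) - f s) := by
  have h1 : IntervalIntegrable (fun θ => f (s + θ)) volume 0 h := by
    have := (intervalIntegrable_of_memLp_two hf (s + 0) (s + h)).comp_add_left (c := s)
    simpa using this
  rw [intervalIntegral.integral_sub h1 intervalIntegrable_const, smul_sub,
    intervalIntegral.integral_comp_add_left, intervalIntegral.integral_const]
  simp [steklov, smul_smul, inv_mul_cancel₀ hh.ne']

/-- The averaging error at `s` is the mean over `θ` of the increments `f (s + θ) - f s`.
Cauchy–Schwarz in `θ` and Tonelli reduce it to translation errors. Strong measurability of `f`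
itself supplies joint measurability in `(s, θ)`. -/
theorem lintegral_steklov_sub_le {E : Type} [NormedAddCommGroup E] [NormedSpace ℝ E]
    [CompleteSpace E] {f : ℝ → E} (hfm : StronglyMeasurable f) (hf : MemLp f 2) {h : ℝ}
    (hh : 0 < h) {ε : ℝ≥0∞} (hε : ∀ θ ∈ Ioc 0 h, eLpNorm (fun s => f (s + θ) - f s) 2 ≤ ε) :
    ∫⁻ s, ‖steklov h f s - f s‖ₑ ^ 2 ≤ ε ^ 2 := by
  have hm : StronglyMeasurable (fun p : ℝ × ℝ => f (p.1 + p.2) - f p.1) :=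
    (hfm.comp_measurable (measurable_fst.add measurable_snd)).sub
      (hfm.comp_measurable measurable_fst)
  calc ∫⁻ s, ‖steklov h f s - f s‖ₑ ^ 2
      ≤ ∫⁻ s, ENNReal.ofReal h⁻¹ * ∫⁻ θ in Ioc 0 h, ‖f (s + θ) - f s‖ₑ ^ 2 := by
        refine lintegral_mono fun s => ?_
        dsimp only
        rw [steklov_sub_eq hf hh, enorm_smul, mul_pow]
        have h1 := enorm_integral_sq_le hh.le (f := fun θ => f (s + θ) - f s)
          (hm.comp_measurable (measurable_prodMk_left (x := s))).aestronglyMeasurable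
        have h2 : ‖h⁻¹‖ₑ = ENNReal.ofReal h⁻¹ := Real.enorm_of_nonneg (by positivity)
        calc ‖h⁻¹‖ₑ ^ 2 * ‖∫ θ in (0 : ℝ)..h, (f (s + θ) - f s)‖ₑ ^ 2
            ≤ ‖h⁻¹‖ₑ ^ 2 * (ENNReal.ofReal (h - 0) *
              ∫⁻ θ in Ioc 0 h, ‖f (s + θ) - f s‖ₑ ^ 2) := by gcongr
          _ = _ := by
              rw [h2, sq, sub_zero, ← mul_assoc, mul_assoc (ENNReal.ofReal h⁻¹),
                ← ENNReal.ofReal_mul (by positivity), inv_mul_cancel₀ hh.ne']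
              simp
    _ = ENNReal.ofReal h⁻¹ * ∫⁻ θ in Ioc 0 h, ∫⁻ s, ‖f (s + θ) - f s‖ₑ ^ 2 := by
        rw [lintegral_const_mul' _ _ ENNReal.ofReal_ne_top,
          lintegral_lintegral_swap]
        exact (hm.enorm.pow_const 2).aemeasurable
    _ ≤ ENNReal.ofReal h⁻¹ * ∫⁻ θ in Ioc 0 h, ε ^ 2 := by
        gcongr ENNReal.ofReal h⁻¹ * ?_
        refine setLIntegral_mono measurable_const fun θ hθ => ?_
        rw [← eLpNorm_two_sq]
        gcongr
        exact hε θ hθ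
    _ = ε ^ 2 := by
        rw [setLIntegral_const, Real.volume_Ioc, sub_zero, mul_comm, mul_assoc,
          ← ENNReal.ofReal_mul hh.le, mul_inv_cancel₀ hh.ne']
        simp

/-- Continuity of the translation action on L², evaluated at the zero translation. -/
theorem tendsto_eLpNorm_translate_sub {E : Type} [NormedAddCommGroup E] {f : ℝ → E}
    (hf : MemLp f 2) :
    Tendsto (fun θ : ℝ => eLpNorm (fun s => f (s + θ) - f s) 2) (𝓝 0) (𝓝 0) := by
  have : Fact ((2 : ℝ≥0∞) ≠ ⊤) := ⟨by norm_num⟩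
  have h1 : Continuous fun θ : ℝ => (DomAddAct.mk θ) +ᵥ (hf.toLp f) :=
    (continuous_id.comp DomAddAct.continuous_mk).vadd continuous_const
  have h2 := (h1.tendsto 0)
  simp only [DomAddAct.mk_zero, zero_vadd] at h2
  have h3 := (Lp.tendsto_Lp_iff_tendsto_eLpNorm' _ _).1 h2
  refine h3.congr fun θ => ?_
  refine eLpNorm_congr_ae ?_
  rw [DomAddAct.mk_vadd_toLp]
  filter_upwards [MemLp.coeFn_toLp (hf.comp_measurePreserving (measurePreserving_vadd θ volume)),
    hf.coeFn_toLp] with s h1 h2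
  simp only [Function.comp_def, vadd_eq_add] at h1
  simp only [Pi.sub_apply, vadd_eq_add, h1, h2, add_comm]

theorem tendsto_steklov_L2 {E : Type} [NormedAddCommGroup E] [NormedSpace ℝ E]
    [CompleteSpace E] {f : ℝ → E} (hf : MemLp f 2) :
    Tendsto (fun h : ℝ => eLpNorm (steklov h f - f) 2) (𝓝[>] 0) (𝓝 0) := by
  -- A strongly measurable representative is needed for Tonelli; averages do not see the change.
  obtain ⟨g, hg, hfg⟩ := hf.1
  have hg2 : MemLp g 2 := hf.ae_eq hfg
  have key : Tendsto (fun h : ℝ => eLpNorm (steklov h g - g) 2) (𝓝[>] 0) (𝓝 0) := by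
    rw [ENNReal.tendsto_nhds_zero]
    intro ε hε
    have := (ENNReal.tendsto_nhds_zero.1 (tendsto_eLpNorm_translate_sub hg2)) ε hε
    obtain ⟨δ, hδ, hδ'⟩ := Metric.eventually_nhds_iff.1 this
    filter_upwards [Ioo_mem_nhdsGT hδ] with h hh
    have h1 := lintegral_steklov_sub_le hg hg2 hh.1 (ε := ε) fun θ hθ => hδ' (by
      rw [Real.dist_eq, sub_zero, abs_of_pos hθ.1]; exact hθ.2.trans_lt hh.2)
    have h2 := eLpNorm_two_sq volume (steklov h g - g)
    simp only [Pi.sub_apply] at h2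
    rw [← h2] at h1
    exact (ENNReal.pow_le_pow_left_iff two_ne_zero).1 h1
  refine key.congr fun h => eLpNorm_congr_ae ?_
  rw [steklov_congr_ae hfg]
  exact (ae_eq_refl _).sub hfg.symm

theorem tendsto_integral_inner_of_eLpNorm {α E : Type} [MeasurableSpace α]
    [NormedAddCommGroup E] [InnerProductSpace ℝ E] {μ : Measure α} {l : Filter ℝ}
    {f g : α → E} {F G : ℝ → α → E} (hf : MemLp f 2 μ) (hg : MemLp g 2 μ)
    (hF : ∀ h, MemLp (F h) 2 μ) (hG : ∀ h, MemLp (G h) 2 μ)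
    (hFf : Tendsto (fun h => eLpNorm (F h - f) 2 μ) l (𝓝 0))
    (hGg : Tendsto (fun h => eLpNorm (G h - g) 2 μ) l (𝓝 0)) :
    Tendsto (fun h => ∫ x, inner ℝ (F h x) (G h x) ∂μ) l (𝓝 (∫ x, inner ℝ (f x) (g x) ∂μ)) := by
  have key : ∀ {f g : α → E} (hf : MemLp f 2 μ) (hg : MemLp g 2 μ),
      ∫ x, inner ℝ (f x) (g x) ∂μ = inner ℝ (hf.toLp f) (hg.toLp g) := by
    intro f g hf hg
    rw [L2.inner_def]
    refine integral_congr_ae ?_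
    filter_upwards [hf.coeFn_toLp, hg.coeFn_toLp] with x h1 h2
    rw [h1, h2]
  rw [key hf hg]
  simp_rw [fun h => key (hF h) (hG h)]
  exact ((Lp.tendsto_Lp_iff_tendsto_eLpNorm'' F hF f hf).2 hFf).inner
    ((Lp.tendsto_Lp_iff_tendsto_eLpNorm'' G hG g hg).2 hGg)

theorem steklov_eq_primitive {E : Type} [NormedAddCommGroup E] [NormedSpace ℝ E] {f : ℝ → E}
    (hf : LocallyIntegrable f) (h : ℝ) : steklov h f = fun s =>
      h⁻¹ • ((∫ τ in (0 : ℝ)..s + h, f τ) - ∫ τ in (0 : ℝ)..s, f τ) := by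
  funext s
  rw [intervalIntegral.integral_interval_sub_left
    (intervalIntegrable_of_locallyIntegrable hf _ _)
    (intervalIntegrable_of_locallyIntegrable hf _ _)]
  rfl

theorem continuous_steklov {E : Type} [NormedAddCommGroup E] [NormedSpace ℝ E]
    {f : ℝ → E} (hf : LocallyIntegrable f) (h : ℝ) : Continuous (steklov h f) := by
  have hi : ∀ a b, IntervalIntegrable f volume a b := intervalIntegrable_of_locallyIntegrable hf
  have h2 := intervalIntegral.continuous_primitive hi 0
  rw [steklov_eq_primitive hf]
  fun_prop

/-- This is the gain from averaging: a merely continuous function acquires a time derivative, namely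
its difference quotient, which is what the integrated momentum balance controls. -/
theorem hasDerivAt_steklov {E : Type} [NormedAddCommGroup E] [NormedSpace ℝ E] [CompleteSpace E]
    {f : ℝ → E} (hf : Continuous f) (h s : ℝ) :
    HasDerivAt (steklov h f) (h⁻¹ • (f (s + h) - f s)) s := by
  have h2 := intervalIntegral.integral_hasDerivAt_right (hf.intervalIntegrable 0 s)
    (hf.stronglyMeasurableAtFilter _ _) hf.continuousAt
  have h3 := intervalIntegral.integral_hasDerivAt_right (hf.intervalIntegrable 0 (s + h))
    (hf.stronglyMeasurableAtFilter _ _) hf.continuousAt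
  rw [steklov_eq_primitive hf.locallyIntegrable]
  exact ((h3.comp_add_const s h).sub h2).const_smul _

theorem tendsto_steklov {E : Type} [NormedAddCommGroup E] [NormedSpace ℝ E] [CompleteSpace E]
    {f : ℝ → E} (hf : Continuous f) (s : ℝ) :
    Tendsto (fun h => steklov h f s) (𝓝[>] 0) (𝓝 (f s)) := by
  have h2 := intervalIntegral.integral_hasDerivAt_right (hf.intervalIntegrable s s)
    (hf.stronglyMeasurableAtFilter _ _) hf.continuousAt
  have := h2.tendsto_slope_zero_right
  simpa [steklov] using this

theorem memLp_steklov_restrict {E : Type} [NormedAddCommGroup E] [NormedSpace ℝ E]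
    {f : ℝ → E} (hf : MemLp f 2) (h a b : ℝ) :
    MemLp (steklov h f) 2 (volume.restrict (Ioc a b)) := by
  have hc := continuous_steklov (locallyIntegrable_of_memLp_two hf) h
  obtain ⟨C, hC⟩ := (isCompact_Icc (a := a) (b := b)).exists_bound_of_continuousOn hc.continuousOn
  refine MemLp.of_bound hc.aestronglyMeasurable C ?_
  filter_upwards [ae_restrict_mem measurableSet_Ioc] with x hx using hC x (Ioc_subset_Icc_self hx)

theorem tendsto_integral_inner_steklov {E : Type} [NormedAddCommGroup E] [InnerProductSpace ℝ E]
    [CompleteSpace E] {f g : ℝ → E} (hf : MemLp f 2) (hg : MemLp g 2) {a b : ℝ} (hab : a ≤ b) :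
    Tendsto (fun h => ∫ s in a..b, inner ℝ (steklov h f s) (steklov h g s)) (𝓝[>] 0)
      (𝓝 (∫ s in a..b, inner ℝ (f s) (g s))) := by
  simp only [intervalIntegral.integral_of_le hab]
  have hr : ∀ {f : ℝ → E}, MemLp f 2 → Tendsto
      (fun h => eLpNorm (steklov h f - f) 2 (volume.restrict (Ioc a b))) (𝓝[>] 0) (𝓝 0) :=
    fun hf => tendsto_of_tendsto_of_tendsto_of_le_of_le tendsto_const_nhds (tendsto_steklov_L2 hf)
      (fun _ => zero_le) fun _ => eLpNorm_mono_measure _ Measure.restrict_le_self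
  exact tendsto_integral_inner_of_eLpNorm (hf.restrict _) (hg.restrict _)
    (fun h => memLp_steklov_restrict hf h a b) (fun h => memLp_steklov_restrict hg h a b)
    (hr hf) (hr hg)

/-! ## Energy identities for weak solutions of abstract evolution equations -/

theorem intervalIntegral_inner_const {H : Type} [NormedAddCommGroup H] [InnerProductSpace ℝ H]
    [CompleteSpace H] {f : ℝ → H} {a b : ℝ} (hf : IntervalIntegrable f volume a b)
    (v : H) : ∫ τ in a..b, inner ℝ (f τ) v = inner ℝ (∫ τ in a..b, f τ) v := by
  have := (innerSL ℝ v).intervalIntegral_comp_comm hf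
  simp only [innerSL_apply_apply] at this
  rw [real_inner_comm, ← this]
  simp only [real_inner_comm]

theorem intervalIntegrable_inner_const {H : Type} [NormedAddCommGroup H] [InnerProductSpace ℝ H]
    {f : ℝ → H} {a b : ℝ}
    (hf : IntervalIntegrable f volume a b) (v : H) :
    IntervalIntegrable (fun τ => inner ℝ (f τ) v) volume a b := by
  have h1 : ∀ τ, inner ℝ (f τ) v = innerSL ℝ v (f τ) := fun τ => real_inner_comm _ _
  simp only [h1]
  exact ⟨(innerSL ℝ v).integrable_comp hf.1, (innerSL ℝ v).integrable_comp hf.2⟩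

theorem integrable_inner_of_memLp {H : Type} [NormedAddCommGroup H] [InnerProductSpace ℝ H]
    {α : Type} [MeasurableSpace α] {μ : Measure α} {f g : α → H}
    (hf : MemLp f 2 μ) (hg : MemLp g 2 μ) : Integrable (fun t => inner ℝ (f t) (g t)) μ := by
  refine (Integrable.add ((memLp_two_iff_integrable_sq_norm hf.1).1 hf)
    ((memLp_two_iff_integrable_sq_norm hg.1).1 hg)).mono'
    (hf.1.inner hg.1) (.of_forall fun t => ?_)
  rw [Real.norm_eq_abs, Pi.add_apply]
  have := abs_real_inner_le_norm (f t) (g t)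
  nlinarith [sq_nonneg (‖f t‖ - ‖g t‖), norm_nonneg (f t), norm_nonneg (g t)]

/-- A momentum balance over `[s, s + h]` in terms of Steklov averages. -/
theorem momentum_steklov {H G Z : Type} [NormedAddCommGroup G] [InnerProductSpace ℝ G]
    [CompleteSpace G] [NormedAddCommGroup Z] [InnerProductSpace ℝ Z] [CompleteSpace Z]
    {g : ℝ → Z} {F : ℝ → G} {s h : ℝ} (hh : 0 < h)
    (hg : IntervalIntegrable g volume s (s + h)) (hF : IntervalIntegrable F volume s (s + h))
    (v : H × G × Z) :
    ∫ τ in s..s + h, (inner ℝ (g τ) v.2.2 - inner ℝ (F τ) v.2.1)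
      = h * (inner ℝ (steklov h g s) v.2.2 - inner ℝ (steklov h F s) v.2.1) := by
  rw [intervalIntegral.integral_sub (intervalIntegrable_inner_const hg _)
    (intervalIntegrable_inner_const hF _), intervalIntegral_inner_const hg,
    intervalIntegral_inner_const hF, steklov, steklov, real_inner_smul_left, real_inner_smul_left]
  field_simp

section Energy

variable {H G Z : Type} [NormedAddCommGroup H] [InnerProductSpace ℝ H] [CompleteSpace H]
  [NormedAddCommGroup G] [InnerProductSpace ℝ G] [CompleteSpace G]
  [NormedAddCommGroup Z] [InnerProductSpace ℝ Z] [CompleteSpace Z]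

/-- A closed convex set contains the averages of its elements. Hence the average of a solution is an
admissible test field. -/
theorem steklov_mem {X : Type} [NormedAddCommGroup X] [NormedSpace ℝ X] [CompleteSpace X]
    (V : Submodule ℝ X) (hV : IsClosed (V : Set X)) {f : ℝ → X} {s h : ℝ} (hh : 0 < h)
    (hf : IntervalIntegrable f volume s (s + h))
    (hmem : ∀ᵐ τ, τ ∈ Ioc s (s + h) → f τ ∈ V) : steklov h f s ∈ V := by
  have hs : s ≤ s + h := by linarith
  have h1 := V.convex.set_average_mem hV (μ := volume) (t := Ioc s (s + h)) (f := f)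
    (by simp [hh]) (by simp) ((ae_restrict_iff' measurableSet_Ioc).2 hmem)
    ((intervalIntegrable_iff_integrableOn_Ioc_of_le hs).1 hf)
  rw [setAverage_eq, ← intervalIntegral.integral_of_le hs] at h1
  simpa [steklov, hh.le] using h1

theorem steklov_prod {X Y : Type} [NormedAddCommGroup X] [NormedSpace ℝ X] [CompleteSpace X]
    [NormedAddCommGroup Y] [NormedSpace ℝ Y] [CompleteSpace Y] {f : ℝ → X} {g : ℝ → Y} {s h : ℝ}
    (hf : IntervalIntegrable f volume s (s + h)) (hg : IntervalIntegrable g volume s (s + h)) :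
    steklov h (fun τ => (f τ, g τ)) s = (steklov h f s, steklov h g s) := by
  have hfg : IntervalIntegrable (fun τ => (f τ, g τ)) volume s (s + h) :=
    ⟨hf.1.prodMk hg.1, hf.2.prodMk hg.2⟩
  have h1 := (ContinuousLinearMap.fst ℝ X Y).intervalIntegral_comp_comm hfg
  have h2 := (ContinuousLinearMap.snd ℝ X Y).intervalIntegral_comp_comm hfg
  simp only [ContinuousLinearMap.coe_fst', ContinuousLinearMap.coe_snd'] at h1 h2
  simp only [steklov, h1, h2]
  rfl

/-- A weak solution of `ρ x' + F = g` (with `F` paired with the gradient `D` and `g` with the trace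
`b`): the energy identity for Steklov averages. -/
theorem parabolic_energy_steklov {V : Submodule ℝ (H × G × Z)}
    (hV : IsClosed (V : Set (H × G × Z))) {ρ a c : ℝ} {x : ℝ → H} {D F : ℝ → G} {b g : ℝ → Z}
    (hx : Continuous x) (hD : MemLp D 2) (hF : MemLp F 2) (hb : MemLp b 2) (hg : MemLp g 2)
    (hmem : ∀ᵐ s, s ∈ Icc a c → (x s, D s, b s) ∈ V)
    (hmom : ∀ v ∈ V, ∀ s ∈ Icc a c, ∀ t ∈ Icc a c, ρ * inner ℝ (x t - x s) v.1 =
      ∫ τ in s..t, (inner ℝ (g τ) v.2.2 - inner ℝ (F τ) v.2.1))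
    {h t : ℝ} (hh : 0 < h) (hat : a ≤ t) (htc : t + h ≤ c) :
    ρ / 2 * ‖steklov h x t‖ ^ 2 - ρ / 2 * ‖steklov h x a‖ ^ 2 =
      (∫ s in a..t, inner ℝ (steklov h g s) (steklov h b s))
        - ∫ s in a..t, inner ℝ (steklov h F s) (steklov h D s) := by
  have hi : ∀ {X : Type} [NormedAddCommGroup X] {f : ℝ → X}, MemLp f 2 → ∀ p q,
      IntervalIntegrable f volume p q := fun hf p q => intervalIntegrable_of_memLp_two hf p q
  have hc : ∀ {X : Type} [NormedAddCommGroup X] [NormedSpace ℝ X] {f : ℝ → X}, MemLp f 2 →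
      Continuous (steklov h f) :=
    fun hf => continuous_steklov (locallyIntegrable_of_memLp_two hf) h
  have c1 := (hc hg).inner (𝕜 := ℝ) (hc hb)
  have c2 := (hc hF).inner (𝕜 := ℝ) (hc hD)
  rw [← intervalIntegral.integral_sub (c1.intervalIntegrable _ _) (c2.intervalIntegrable _ _)]
  -- The derivative of the averaged kinetic energy is the momentum balance over `[s, s + h]`,
  -- divided by `h` and tested with the average of the solution over the same interval.
  refine (intervalIntegral.integral_eq_sub_of_hasDerivAt
    (f := fun s => ρ / 2 * ‖steklov h x s‖ ^ 2) (fun s hs => ?_)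
    ((c1.sub c2).intervalIntegrable _ _)).symm
  rw [uIcc_of_le hat] at hs
  have hsa : s ∈ Icc a c := ⟨hs.1, by linarith [hs.2]⟩
  have hsh : s + h ∈ Icc a c := ⟨by linarith [hs.1], by linarith [hs.2]⟩
  have hvmem : (steklov h x s, steklov h D s, steklov h b s) ∈ V := by
    have e1 := steklov_prod (hi hD s (s + h)) (hi hb s (s + h))
    have e2 := steklov_prod (hx.intervalIntegrable s (s + h))
      (g := fun τ => (D τ, b τ))
      ⟨(hi hD s _).1.prodMk (hi hb s _).1, (hi hD s _).2.prodMk (hi hb s _).2⟩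
    rw [e1] at e2
    rw [← e2]
    refine steklov_mem V hV hh ?_ ?_
    · exact ⟨(hx.intervalIntegrable s _).1.prodMk ((hi hD s _).1.prodMk (hi hb s _).1),
        (hx.intervalIntegrable s _).2.prodMk ((hi hD s _).2.prodMk (hi hb s _).2)⟩
    · filter_upwards [hmem] with τ hτ hτ2
      exact hτ ⟨hs.1.trans hτ2.1.le, hτ2.2.trans hsh.2⟩
  have hd := ((hasDerivAt_steklov hx h s).norm_sq).const_mul (ρ / 2)
  refine hd.congr_deriv ?_
  have hm := hmom _ hvmem s hsa (s + h) hsh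
  rw [momentum_steklov hh (hi hg _ _) (hi hF _ _)] at hm
  rw [real_inner_smul_right, real_inner_comm]
  dsimp only at hm
  simp only [Pi.sub_apply]
  field_simp
  linarith

/-- A weak solution of `ρ y'' + A D = g` (with `A D` paired with the gradient `D` of `y` and `g`
with the trace `r`): the energy identity for Steklov averages. -/
theorem hyperbolic_energy_steklov {V : Submodule ℝ (H × G × Z)} {ρ a c : ℝ} (A : G →L[ℝ] G)
    (hA : ∀ p q, inner ℝ (A p) q = inner ℝ p (A q))
    {y x : ℝ → H} {D : ℝ → G} {r b g : ℝ → Z}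
    (hx : Continuous x) (hD : Continuous D) (hb : MemLp b 2) (hg : MemLp g 2)
    (hmem : ∀ s ∈ Icc a c, (y s, D s, r s) ∈ V)
    (hy : ∀ s ∈ Icc a c, ∀ t ∈ Icc a c, y t - y s = ∫ τ in s..t, x τ)
    (hr : ∀ s ∈ Icc a c, ∀ t ∈ Icc a c, r t - r s = ∫ τ in s..t, b τ)
    (hmom : ∀ v ∈ V, ∀ s ∈ Icc a c, ∀ t ∈ Icc a c, ρ * inner ℝ (x t - x s) v.1 =
      ∫ τ in s..t, (inner ℝ (g τ) v.2.2 - inner ℝ (A (D τ)) v.2.1))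
    {h t : ℝ} (hh : 0 < h) (hat : a ≤ t) (htc : t + h ≤ c) :
    (ρ / 2 * ‖steklov h x t‖ ^ 2 + 1 / 2 * inner ℝ (A (steklov h D t)) (steklov h D t))
      - (ρ / 2 * ‖steklov h x a‖ ^ 2 + 1 / 2 * inner ℝ (A (steklov h D a)) (steklov h D a)) =
      ∫ s in a..t, inner ℝ (steklov h g s) (steklov h b s) := by
  have hc : ∀ {X : Type} [NormedAddCommGroup X] [NormedSpace ℝ X] {f : ℝ → X}, MemLp f 2 →
      Continuous (steklov h f) :=
    fun hf => continuous_steklov (locallyIntegrable_of_memLp_two hf) h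
  have c1 := (hc hg).inner (𝕜 := ℝ) (hc hb)
  refine (intervalIntegral.integral_eq_sub_of_hasDerivAt
    (f := fun s => ρ / 2 * ‖steklov h x s‖ ^ 2
      + 1 / 2 * inner ℝ (A (steklov h D s)) (steklov h D s)) (fun s hs => ?_)
    (c1.intervalIntegrable _ _)).symm
  rw [uIcc_of_le hat] at hs
  have hsa : s ∈ Icc a c := ⟨hs.1, by linarith [hs.2]⟩
  have hsh : s + h ∈ Icc a c := ⟨by linarith [hs.1], by linarith [hs.2]⟩
  -- The solid velocity need not have a gradient. The test field is the difference quotient of the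
  -- displacement: its value and trace are the averages of `x` and `b`, and its gradient is the time
  -- derivative of the average of `D`.
  have hvmem := V.smul_mem h⁻¹ (V.sub_mem (hmem _ hsh) (hmem _ hsa))
  simp only [Prod.mk_sub_mk, Prod.smul_mk] at hvmem
  rw [hy s hsa _ hsh, hr s hsa _ hsh] at hvmem
  have hd1 := ((hasDerivAt_steklov hx h s).norm_sq).const_mul (ρ / 2)
  have hdD := hasDerivAt_steklov hD h s
  have hd2 := ((A.hasFDerivAt.comp_hasDerivAt s hdD).inner ℝ hdD).const_mul (1 / 2)
  refine (hd1.add hd2).congr_deriv ?_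
  have hm := hmom _ hvmem s hsa (s + h) hsh
  rw [momentum_steklov (F := fun τ => A (D τ)) hh (intervalIntegrable_of_memLp_two hg _ _)
    ((A.continuous.comp hD).intervalIntegrable _ _)] at hm
  have hAD : steklov h (fun τ => A (D τ)) s = A (steklov h D s) := by
    rw [steklov, A.intervalIntegral_comp_comm (hD.intervalIntegrable _ _), ← map_smul, steklov]
  dsimp only at hm
  change ρ * inner ℝ (x (s + h) - x s) (steklov h x s) =
    h * (inner ℝ (steklov h g s) (steklov h b s) -
      inner ℝ (steklov h (fun τ => A (D τ)) s) _) at hm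
  rw [hAD] at hm
  -- Symmetry of `A` makes the two terms of the derivative of the quadratic form equal, which
  -- cancels the factor 1/2.
  rw [Function.comp_apply, hA (h⁻¹ • _), real_inner_comm _ (h⁻¹ • (D (s + h) - D s)),
    real_inner_smul_right (steklov h x s), real_inner_comm _ (steklov h x s)]
  generalize h⁻¹ • (D (s + h) - D s) = w at hm ⊢
  field_simp
  linarith

/-- Forward averages at the right endpoint would leave the interval, so the limit h → 0 is taken at
earlier times and the endpoint is reached by continuity. -/
theorem eq_of_forall_lt_of_continuousOn {f g : ℝ → ℝ} {a c : ℝ} (hac : a < c)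
    (hf : ContinuousOn f (Icc a c)) (hg : ContinuousOn g (Icc a c))
    (h : ∀ t ∈ Ico a c, f t = g t) : f c = g c := by
  have hne : (𝓝[Ico a c] c).NeBot := by
    rw [← mem_closure_iff_nhdsWithin_neBot, closure_Ico hac.ne]
    exact ⟨hac.le, le_rfl⟩
  have h1 := (hf c ⟨hac.le, le_rfl⟩).mono Ico_subset_Icc_self
  have h2 := (hg c ⟨hac.le, le_rfl⟩).mono Ico_subset_Icc_self
  exact tendsto_nhds_unique h1.tendsto
    (h2.tendsto.congr' (by filter_upwards [self_mem_nhdsWithin] with t ht using (h t ht).symm))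

theorem eventually_add_le {t c : ℝ} (ht : t < c) : ∀ᶠ h in 𝓝[>] (0 : ℝ), 0 < h ∧ t + h ≤ c := by
  filter_upwards [Ioo_mem_nhdsGT (sub_pos.2 ht)] with h hh
  exact ⟨hh.1, by linarith [hh.2]⟩

/-- As h → 0 the energies converge pointwise, since `x` is continuous, and the pairings converge
because averages converge in L². -/
theorem parabolic_energy_real {V : Submodule ℝ (H × G × Z)}
    (hV : IsClosed (V : Set (H × G × Z))) {ρ a c : ℝ} (hac : a < c) {x : ℝ → H} {D F : ℝ → G}
    {b g : ℝ → Z}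
    (hx : Continuous x) (hD : MemLp D 2) (hF : MemLp F 2) (hb : MemLp b 2) (hg : MemLp g 2)
    (hmem : ∀ᵐ s, s ∈ Icc a c → (x s, D s, b s) ∈ V)
    (hmom : ∀ v ∈ V, ∀ s ∈ Icc a c, ∀ t ∈ Icc a c, ρ * inner ℝ (x t - x s) v.1 =
      ∫ τ in s..t, (inner ℝ (g τ) v.2.2 - inner ℝ (F τ) v.2.1)) :
    ρ / 2 * ‖x c‖ ^ 2 - ρ / 2 * ‖x a‖ ^ 2 =
      (∫ s in a..c, inner ℝ (g s) (b s)) - ∫ s in a..c, inner ℝ (F s) (D s) := by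
  refine eq_of_forall_lt_of_continuousOn (f := fun t => ρ / 2 * ‖x t‖ ^ 2 - ρ / 2 * ‖x a‖ ^ 2)
    (g := fun t => (∫ s in a..t, inner ℝ (g s) (b s)) - ∫ s in a..t, inner ℝ (F s) (D s)) hac
    (by fun_prop) ?_ fun t ht => ?_
  · have h1 := intervalIntegral.continuous_primitive (μ := volume)
      (fun p q => (integrable_inner_of_memLp hg hb).intervalIntegrable (a := p) (b := q)) a
    have h2 := intervalIntegral.continuous_primitive (μ := volume)
      (fun p q => (integrable_inner_of_memLp hF hD).intervalIntegrable (a := p) (b := q)) a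
    exact (h1.sub h2).continuousOn
  · have l1 := ((((tendsto_steklov hx t).norm.pow 2).const_mul (ρ / 2)).sub
      (((tendsto_steklov hx a).norm.pow 2).const_mul (ρ / 2)))
    have l2 := (tendsto_integral_inner_steklov hg hb ht.1).sub
      (tendsto_integral_inner_steklov hF hD ht.1)
    refine tendsto_nhds_unique l1 (l2.congr' ?_)
    filter_upwards [eventually_add_le ht.2] with h hh
    exact (parabolic_energy_steklov hV hx hD hF hb hg hmem hmom hh.1 ht.1 hh.2).symm

theorem hyperbolic_energy_real {V : Submodule ℝ (H × G × Z)} {ρ a c : ℝ} (hac : a < c)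
    (A : G →L[ℝ] G) (hA : ∀ p q, inner ℝ (A p) q = inner ℝ p (A q))
    {y x : ℝ → H} {D : ℝ → G} {r b g : ℝ → Z}
    (hx : Continuous x) (hD : Continuous D) (hb : MemLp b 2) (hg : MemLp g 2)
    (hmem : ∀ s ∈ Icc a c, (y s, D s, r s) ∈ V)
    (hy : ∀ s ∈ Icc a c, ∀ t ∈ Icc a c, y t - y s = ∫ τ in s..t, x τ)
    (hr : ∀ s ∈ Icc a c, ∀ t ∈ Icc a c, r t - r s = ∫ τ in s..t, b τ)
    (hmom : ∀ v ∈ V, ∀ s ∈ Icc a c, ∀ t ∈ Icc a c, ρ * inner ℝ (x t - x s) v.1 =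
      ∫ τ in s..t, (inner ℝ (g τ) v.2.2 - inner ℝ (A (D τ)) v.2.1)) :
    (ρ / 2 * ‖x c‖ ^ 2 + 1 / 2 * inner ℝ (A (D c)) (D c))
      - (ρ / 2 * ‖x a‖ ^ 2 + 1 / 2 * inner ℝ (A (D a)) (D a)) =
      ∫ s in a..c, inner ℝ (g s) (b s) := by
  refine eq_of_forall_lt_of_continuousOn
    (f := fun t => (ρ / 2 * ‖x t‖ ^ 2 + 1 / 2 * inner ℝ (A (D t)) (D t))
      - (ρ / 2 * ‖x a‖ ^ 2 + 1 / 2 * inner ℝ (A (D a)) (D a)))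
    (g := fun t => ∫ s in a..t, inner ℝ (g s) (b s)) hac
    (by fun_prop) ?_ fun t ht => ?_
  · exact (intervalIntegral.continuous_primitive (μ := volume)
      (fun p q => (integrable_inner_of_memLp hg hb).intervalIntegrable (a := p) (b := q))
      a).continuousOn
  · have l0 : ∀ s, Tendsto (fun h => ρ / 2 * ‖steklov h x s‖ ^ 2
        + 1 / 2 * inner ℝ (A (steklov h D s)) (steklov h D s)) (𝓝[>] 0)
        (𝓝 (ρ / 2 * ‖x s‖ ^ 2 + 1 / 2 * inner ℝ (A (D s)) (D s))) := fun s =>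
      (((tendsto_steklov hx s).norm.pow 2).const_mul (ρ / 2)).add
        ((((A.continuous.tendsto _).comp (tendsto_steklov hD s)).inner
          (tendsto_steklov hD s)).const_mul (1 / 2))
    refine tendsto_nhds_unique ((l0 t).sub (l0 a))
      ((tendsto_integral_inner_steklov hg hb ht.1).congr' ?_)
    filter_upwards [eventually_add_le ht.2] with h hh
    exact (hyperbolic_energy_steklov A hA hx hD hb hg hmem hy hr hmom hh.1 ht.1 hh.2).symm

/-! ### Energy identities for data on a bounded time interval -/

theorem memLp_indicator_of_L2Time {E : Type} [NormedAddCommGroup E] {a c : ℝ} {f : ℝ → E}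
    (hf : L2Time a c f) :
    MemLp ((Icc a c).indicator f) 2 :=
  (memLp_indicator_iff_restrict measurableSet_Icc).2 hf

theorem intervalIntegral_congr_Icc {E : Type} [NormedAddCommGroup E] [NormedSpace ℝ E]
    {a c s t : ℝ} (hs : s ∈ Icc a c) (ht : t ∈ Icc a c) {f g : ℝ → E}
    (h : ∀ τ ∈ Icc a c, f τ = g τ) : ∫ τ in s..t, f τ = ∫ τ in s..t, g τ :=
  intervalIntegral.integral_congr fun τ hτ => h τ (uIcc_subset_Icc hs ht hτ)

/-- The energy identity for a weak solution of `ρ x' + F = g` on `[a, c]`. -/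
theorem parabolic_energy {V : Submodule ℝ (H × G × Z)}
    (hV : IsClosed (V : Set (H × G × Z))) {ρ a c : ℝ} (hac : a < c) {x : ℝ → H} {D F : ℝ → G}
    {b g : ℝ → Z} (hx : ContinuousOn x (Icc a c)) (hD : L2Time a c D) (hF : L2Time a c F)
    (hb : L2Time a c b) (hg : L2Time a c g)
    (hmem : ∀ᵐ s ∂(volume.restrict (Icc a c)), (x s, D s, b s) ∈ V)
    (hmom : ∀ v ∈ V, ∀ s ∈ Icc a c, ∀ t ∈ Icc a c, ρ * inner ℝ (x t - x s) v.1 =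
      ∫ τ in s..t, (inner ℝ (g τ) v.2.2 - inner ℝ (F τ) v.2.1)) :
    ρ / 2 * ‖x c‖ ^ 2 - ρ / 2 * ‖x a‖ ^ 2 =
      (∫ s in a..c, inner ℝ (g s) (b s)) - ∫ s in a..c, inner ℝ (F s) (D s) := by
  have ha : a ∈ Icc a c := ⟨le_rfl, hac.le⟩
  have hc : c ∈ Icc a c := ⟨hac.le, le_rfl⟩
  -- Constant extension keeps the velocity continuous on ℝ, and extension by zero keeps the
  -- remaining data in L²; the hypotheses and the identity only see `[a, c]`.
  set x' := IccExtend hac.le ((Icc a c).domRestrict x) with hx'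
  have ex : ∀ s ∈ Icc a c, x' s = x s := fun s hs => by rw [hx', IccExtend_of_mem _ _ hs]; rfl
  have key := parabolic_energy_real hV (ρ := ρ) hac (x := x')
    (continuousOn_iff_continuous_domRestrict.1 hx).Icc_extend'
    (memLp_indicator_of_L2Time hD) (memLp_indicator_of_L2Time hF) (memLp_indicator_of_L2Time hb)
    (memLp_indicator_of_L2Time hg) ?_ ?_
  · rw [ex a ha, ex c hc] at key
    rw [key]
    congr 1 <;>
    exact intervalIntegral_congr_Icc ha hc fun s hs => by
      simp only [indicator_of_mem hs]
  · rw [ae_restrict_iff' measurableSet_Icc] at hmem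
    filter_upwards [hmem] with s h hs
    simpa only [indicator_of_mem hs, ex s hs] using h hs
  · intro v hv s hs t ht
    rw [ex s hs, ex t ht, hmom v hv s hs t ht]
    exact intervalIntegral_congr_Icc hs ht fun τ hτ => by
      simp only [indicator_of_mem hτ]

/-- The energy identity for a weak solution of `ρ y'' + A D = g` on `[a, c]`. -/
theorem hyperbolic_energy {V : Submodule ℝ (H × G × Z)} {ρ a c : ℝ} (hac : a < c)
    (A : G →L[ℝ] G) (hA : ∀ p q, inner ℝ (A p) q = inner ℝ p (A q))
    {y x : ℝ → H} {D : ℝ → G} {r b g : ℝ → Z}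
    (hx : ContinuousOn x (Icc a c)) (hD : ContinuousOn D (Icc a c)) (hb : L2Time a c b)
    (hg : L2Time a c g)
    (hmem : ∀ s ∈ Icc a c, (y s, D s, r s) ∈ V)
    (hy : ∀ s ∈ Icc a c, ∀ t ∈ Icc a c, y t - y s = ∫ τ in s..t, x τ)
    (hr : ∀ s ∈ Icc a c, ∀ t ∈ Icc a c, r t - r s = ∫ τ in s..t, b τ)
    (hmom : ∀ v ∈ V, ∀ s ∈ Icc a c, ∀ t ∈ Icc a c, ρ * inner ℝ (x t - x s) v.1 =
      ∫ τ in s..t, (inner ℝ (g τ) v.2.2 - inner ℝ (A (D τ)) v.2.1)) :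
    (ρ / 2 * ‖x c‖ ^ 2 + 1 / 2 * inner ℝ (A (D c)) (D c))
      - (ρ / 2 * ‖x a‖ ^ 2 + 1 / 2 * inner ℝ (A (D a)) (D a)) =
      ∫ s in a..c, inner ℝ (g s) (b s) := by
  have ha : a ∈ Icc a c := ⟨le_rfl, hac.le⟩
  have hc : c ∈ Icc a c := ⟨hac.le, le_rfl⟩
  set x' := IccExtend hac.le ((Icc a c).domRestrict x) with hx'
  set D' := IccExtend hac.le ((Icc a c).domRestrict D) with hD'
  have ex : ∀ s ∈ Icc a c, x' s = x s := fun s hs => by rw [hx', IccExtend_of_mem _ _ hs]; rfl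
  have eD : ∀ s ∈ Icc a c, D' s = D s := fun s hs => by rw [hD', IccExtend_of_mem _ _ hs]; rfl
  have key := hyperbolic_energy_real (V := V) (ρ := ρ) hac A hA (y := y) (r := r) (x := x')
    (D := D') (continuousOn_iff_continuous_domRestrict.1 hx).Icc_extend'
    (continuousOn_iff_continuous_domRestrict.1 hD).Icc_extend' (memLp_indicator_of_L2Time hb)
    (memLp_indicator_of_L2Time hg) ?_ ?_ ?_ ?_
  · rw [ex a ha, ex c hc, eD a ha, eD c hc] at key
    rw [key]
    exact intervalIntegral_congr_Icc ha hc fun s hs => by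
      simp only [indicator_of_mem hs]
  · intro s hs
    rw [eD s hs]
    exact hmem s hs
  · intro s hs t ht
    rw [hy s hs t ht]
    exact intervalIntegral_congr_Icc hs ht fun τ hτ => (ex τ hτ).symm
  · intro s hs t ht
    rw [hr s hs t ht]
    exact intervalIntegral_congr_Icc hs ht fun τ hτ => by rw [indicator_of_mem hτ]
  · intro v hv s hs t ht
    rw [ex s hs, ex t ht, hmom v hv s hs t ht]
    exact intervalIntegral_congr_Icc hs ht fun τ hτ => by
      simp only [indicator_of_mem hτ, eD τ hτ]

end Energy

/-! ## The gradient of a Sobolev field is unique -/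

theorem memLp_of_continuous_hasCompactSupport {d : ℕ} {F : Type} [NormedAddCommGroup F]
    {Ω : Set (Vec d)} {f : Vec d → F} (hf : Continuous f) (hs : HasCompactSupport f) :
    MemLp f 2 ((volume : Measure (Vec d)).restrict Ω) :=
  (hf.memLp_of_hasCompactSupport hs).restrict Ω

/-- The integration by parts formula, extended from smooth fields to the Sobolev graph. -/
theorem sobolevGraph_inner_test {d : ℕ} {Ω Γ : Set (Vec d)} {ψ : Vec d → ℝ} (hψ : ContDiff ℝ ∞ ψ)
    (hc : HasCompactSupport ψ) (hΩ : tsupport ψ ⊆ Ω) (i j : Fin d)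
    {z : L2Vol Ω (Vec d) × L2Vol Ω (Ten d) × L2Surf Γ} (hz : z ∈ sobolevGraph Ω Γ) :
    (∫ x in Ω, ψ x * z.2.1 x (i, j))
      + ∫ x in Ω, fderiv ℝ ψ x (EuclideanSpace.single j 1) * z.1 x i = 0 := by
  set e : Vec d := EuclideanSpace.single j 1
  have hψd : Continuous fun x => fderiv ℝ ψ x e :=
    (hψ.continuous_fderiv (by simp)).clm_apply continuous_const
  have hψdc : HasCompactSupport fun x => fderiv ℝ ψ x e :=
    (hc.fderiv (𝕜 := ℝ)).comp_left (g := fun L : Vec d →L[ℝ] ℝ => L e) (by simp)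
  have m1 : MemLp (fun x => ψ x • (EuclideanSpace.single (i, j) 1 : Ten d)) 2
      ((volume : Measure (Vec d)).restrict Ω) :=
    memLp_of_continuous_hasCompactSupport (hψ.continuous.smul continuous_const) hc.smul_right
  have m2 : MemLp (fun x => fderiv ℝ ψ x e • (EuclideanSpace.single i 1 : Vec d)) 2
      ((volume : Measure (Vec d)).restrict Ω) :=
    memLp_of_continuous_hasCompactSupport (hψd.smul continuous_const) hψdc.smul_right
  -- The formula is the vanishing of a continuous functional, so it passes from smooth fields to the
  -- closure of their span.
  let ℓ : (L2Vol Ω (Vec d) × L2Vol Ω (Ten d) × L2Surf Γ) →L[ℝ] ℝ :=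
    (innerSL ℝ (m1.toLp _)).comp ((ContinuousLinearMap.fst ℝ _ _).comp
      (ContinuousLinearMap.snd ℝ _ _))
    + (innerSL ℝ (m2.toLp _)).comp (ContinuousLinearMap.fst ℝ _ _)
  have hℓ : ∀ z, ℓ z = (∫ x in Ω, ψ x * z.2.1 x (i, j))
      + ∫ x in Ω, fderiv ℝ ψ x e * z.1 x i := by
    intro z
    change inner ℝ (m1.toLp _) z.2.1 + inner ℝ (m2.toLp _) z.1 = _
    rw [L2.inner_def, L2.inner_def]
    congr 1
    · refine integral_congr_ae ?_
      filter_upwards [m1.coeFn_toLp] with x hx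
      rw [hx, real_inner_smul_left, EuclideanSpace.inner_single_left]
      simp
    · refine integral_congr_ae ?_
      filter_upwards [m2.coeFn_toLp] with x hx
      rw [hx, real_inner_smul_left, EuclideanSpace.inner_single_left]
      simp
  rw [← hℓ]
  suffices h : sobolevGraph Ω Γ ≤ LinearMap.ker ℓ.toLinearMap from h hz
  refine Submodule.topologicalClosure_minimal _ ?_ ℓ.isClosed_ker
  rw [Submodule.span_le]
  rintro z ⟨φ, hφ, hφc, h1, h2, -⟩
  change ℓ z = 0
  rw [hℓ]
  have hφi : ContDiff ℝ ∞ fun x => φ x i :=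
    (EuclideanSpace.proj (𝕜 := ℝ) i).contDiff.comp hφ
  have hφd : ∀ x, fderiv ℝ φ x e i = fderiv ℝ (fun x => φ x i) x e := by
    intro x
    have hd : HasFDerivAt (fun x => φ x i)
        ((EuclideanSpace.proj (𝕜 := ℝ) i).comp (fderiv ℝ φ x)) x :=
      (EuclideanSpace.proj (𝕜 := ℝ) i).hasFDerivAt.comp x
        ((hφ.differentiable (by simp)) x).hasFDerivAt
    rw [hd.fderiv]
    rfl
  have hφdc : Continuous fun x => fderiv ℝ (fun x => φ x i) x e :=
    (hφi.continuous_fderiv (by simp)).clm_apply continuous_const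
  -- Since `ψ` is supported in `Ω`, the integrals extend to the whole space and integration by parts
  -- has no boundary term.
  have e1 : ∫ x in Ω, ψ x * z.2.1 x (i, j) = ∫ x, ψ x * fderiv ℝ (fun x => φ x i) x e := by
    rw [← setIntegral_eq_integral_of_forall_compl_eq_zero (s := Ω)
      (f := fun x => ψ x * fderiv ℝ (fun x => φ x i) x e)]
    · refine integral_congr_ae ?_
      filter_upwards [h2] with x hx
      rw [hx, ← hφd]
      rfl
    · intro x hx
      rw [image_eq_zero_of_notMem_tsupport fun h => hx (hΩ h), zero_mul]
  have e2 : ∫ x in Ω, fderiv ℝ ψ x e * z.1 x i = ∫ x, fderiv ℝ ψ x e * φ x i := by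
    rw [← setIntegral_eq_integral_of_forall_compl_eq_zero (s := Ω)
      (f := fun x => fderiv ℝ ψ x e * φ x i)]
    · refine integral_congr_ae ?_
      filter_upwards [h1] with x hx
      rw [hx]
    · intro x hx
      have : fderiv ℝ ψ x = 0 := image_eq_zero_of_notMem_tsupport
        fun h => hx (hΩ (tsupport_fderiv_subset ℝ h))
      simp [this]
  rw [e1, e2, integral_mul_fderiv_eq_neg_fderiv_mul_of_integrable]
  · simp
  · exact (hψd.mul hφi.continuous).integrable_of_hasCompactSupport hψdc.mul_right
  · exact (hψ.continuous.mul hφdc).integrable_of_hasCompactSupport hc.mul_right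
  · exact (hψ.continuous.mul hφi.continuous).integrable_of_hasCompactSupport hc.mul_right
  · exact fun x _ => hψ.differentiable (by simp) x
  · exact fun x _ => hφi.differentiable (by simp) x

/-- For the zero field, integration by parts leaves the integrals of `G` against test functions,
which must vanish; the fundamental lemma of the calculus of variations concludes. Boundedness of `Ω`
makes `G` integrable. -/
theorem sobolevGraph_grad_eq_zero {d : ℕ} {Ω Γ : Set (Vec d)} (hΩ : IsOpen Ω)
    (hb : Bornology.IsBounded Ω) {G : L2Vol Ω (Ten d)} {y : L2Surf Γ}
    (hz : (0, G, y) ∈ sobolevGraph Ω Γ) : G = 0 := by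
  have : IsFiniteMeasure ((volume : Measure (Vec d)).restrict Ω) :=
    ⟨by simpa using hb.measure_lt_top⟩
  have key : ∀ ij : Fin d × Fin d, ∀ᵐ x, x ∈ Ω → G x ij = 0 := by
    rintro ⟨i, j⟩
    refine hΩ.ae_eq_zero_of_integral_contDiff_smul_eq_zero (IntegrableOn.locallyIntegrableOn ?_)
      fun ψ hψ hc hs => ?_
    · exact (EuclideanSpace.proj (𝕜 := ℝ) (i, j)).integrable_comp
        ((Lp.memLp G).integrable (by norm_num))
    · have h := sobolevGraph_inner_test hψ hc hs i j hz
      have h0 : ∫ x in Ω, fderiv ℝ ψ x (EuclideanSpace.single j 1) *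
          ((0 : L2Vol Ω (Vec d)) : Vec d → Vec d) x i = 0 := by
        rw [← integral_zero (Vec d) ℝ (μ := volume.restrict Ω)]
        refine integral_congr_ae ?_
        filter_upwards [Lp.coeFn_zero (Vec d) 2 ((volume : Measure (Vec d)).restrict Ω)] with x hx
        rw [hx]
        simp
      dsimp only at h
      rw [h0, add_zero] at h
      rw [← h, setIntegral_eq_integral_of_forall_compl_eq_zero]
      · rfl
      · intro x hx
        rw [image_eq_zero_of_notMem_tsupport fun h => hx (hs h), zero_mul]
  rw [Lp.eq_zero_iff_ae_eq_zero]
  rw [EventuallyEq, ae_restrict_iff' hΩ.measurableSet]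
  filter_upwards [ae_all_iff.2 key] with x hx hxΩ
  ext ij
  simpa using hx ij hxΩ

theorem sobolevGraph_grad_unique {d : ℕ} {Ω Γ : Set (Vec d)} (hΩ : IsOpen Ω)
    (hb : Bornology.IsBounded Ω) {v : L2Vol Ω (Vec d)} {G G' : L2Vol Ω (Ten d)} {y y' : L2Surf Γ}
    (hz : (v, G, y) ∈ sobolevGraph Ω Γ) (hz' : (v, G', y') ∈ sobolevGraph Ω Γ) : G = G' := by
  have h := (sobolevGraph Ω Γ).sub_mem hz hz'
  simp only [Prod.mk_sub_mk, sub_self] at h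
  exact sub_eq_zero.1 (sobolevGraph_grad_eq_zero hΩ hb h)

/-! ## The energy space and the stress tensors -/

/-- `energySpace`, as a subspace. -/
noncomputable def energySubmodule {d : ℕ} (Ω Γ : Set (Vec d)) :
    Submodule ℝ (L2Vol Ω (Vec d) × L2Vol Ω (Ten d) × L2Surf Γ) :=
  sobolevGraph Ω Γ ⊓ (sobolevGraph Ω (frontier Ω \ Γ)).comap
    ((ContinuousLinearMap.fst ℝ (L2Vol Ω (Vec d)) (L2Vol Ω (Ten d) × L2Surf Γ)).prod
      (((ContinuousLinearMap.fst ℝ (L2Vol Ω (Ten d)) (L2Surf Γ)).comp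
        (ContinuousLinearMap.snd ℝ (L2Vol Ω (Vec d)) (L2Vol Ω (Ten d) × L2Surf Γ))).prod
          0)).toLinearMap

theorem mem_energySubmodule {d : ℕ} {Ω Γ : Set (Vec d)}
    {z : L2Vol Ω (Vec d) × L2Vol Ω (Ten d) × L2Surf Γ} :
    z ∈ energySubmodule Ω Γ ↔ z ∈ energySpace Ω Γ := by
  rw [energySubmodule, Submodule.mem_inf, Submodule.mem_comap, energySpace, mem_ofPred_eq]
  rfl

theorem isClosed_sobolevGraph {d : ℕ} (Ω Γ : Set (Vec d)) :
    IsClosed (sobolevGraph Ω Γ : Set (L2Vol Ω (Vec d) × L2Vol Ω (Ten d) × L2Surf Γ)) :=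
  Submodule.isClosed_topologicalClosure _

theorem isClosed_energySubmodule {d : ℕ} (Ω Γ : Set (Vec d)) :
    IsClosed (energySubmodule Ω Γ : Set (L2Vol Ω (Vec d) × L2Vol Ω (Ten d) × L2Surf Γ)) := by
  rw [energySubmodule, Submodule.coe_inf, Submodule.comap_coe]
  exact (isClosed_sobolevGraph Ω Γ).inter
    ((isClosed_sobolevGraph Ω (frontier Ω \ Γ)).preimage (ContinuousLinearMap.continuous _))

/-! ### Symmetric gradient, divergence and stresses as bounded operators -/

/-- The symmetric gradient as a continuous linear map of the gradient. -/
noncomputable def symGradL {d : ℕ} (Ω : Set (Vec d)) : L2Vol Ω (Ten d) →L[ℝ] L2Vol Ω (Ten d) :=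
  (symPart d).compLpL 2 _

/-- The divergence as a continuous linear map of the gradient. -/
noncomputable def divgL {d : ℕ} (Ω : Set (Vec d)) : L2Vol Ω (Ten d) →L[ℝ] L2Vol Ω ℝ :=
  (tenTrace d).compLpL 2 _

/-- The map `q ↦ q I` on square integrable fields. -/
noncomputable def scalarTenL {d : ℕ} (Ω : Set (Vec d)) : L2Vol Ω ℝ →L[ℝ] L2Vol Ω (Ten d) :=
  (scalarTen d).compLpL 2 _

/-- Pointwise adjoints are adjoints on L². This is applied to the self-adjoint symmetric part and to
the pair `scalarTen`, `tenTrace`. -/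
theorem inner_compLp {α E F : Type} [MeasurableSpace α] {m : Measure α}
    [NormedAddCommGroup E] [InnerProductSpace ℝ E]
    [NormedAddCommGroup F] [InnerProductSpace ℝ F] (K : E →L[ℝ] F) (L : F →L[ℝ] E)
    (h : ∀ x y, inner ℝ (K x) y = inner ℝ x (L y)) (f : Lp E 2 m) (g : Lp F 2 m) :
    inner ℝ (K.compLp f) g = inner ℝ f (L.compLp g) := by
  rw [L2.inner_def, L2.inner_def]
  refine integral_congr_ae ?_
  filter_upwards [K.coeFn_compLp f, L.coeFn_compLp g] with x h1 h2
  rw [h1, h2, h]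

theorem symPart_apply {d : ℕ} (A : Ten d) (ij : Fin d × Fin d) :
    symPart d A ij = (A (ij.1, ij.2) + A (ij.2, ij.1)) / 2 := rfl

theorem tenTrace_apply {d : ℕ} (A : Ten d) : tenTrace d A = ∑ i, A (i, i) := rfl

theorem scalarTen_apply {d : ℕ} (q : ℝ) (ij : Fin d × Fin d) :
    scalarTen d q ij = if ij.1 = ij.2 then q else 0 := rfl

theorem inner_symPart {d : ℕ} (A B : Ten d) :
    inner ℝ (symPart d A) B = inner ℝ A (symPart d B) := by
  have h : ∑ ij : Fin d × Fin d, A (ij.2, ij.1) * B ij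
      = ∑ ij : Fin d × Fin d, A ij * B (ij.2, ij.1) :=
    Fintype.sum_equiv (Equiv.prodComm _ _) _ _ fun ij => rfl
  simp only [PiLp.inner_apply, symPart_apply, RCLike.inner_apply, conj_trivial]
  have e1 : ∀ ij : Fin d × Fin d, B ij * ((A (ij.1, ij.2) + A (ij.2, ij.1)) / 2)
      = (A ij * B ij) / 2 + (A (ij.2, ij.1) * B ij) / 2 := fun ij => by ring
  have e2 : ∀ ij : Fin d × Fin d, (B (ij.1, ij.2) + B (ij.2, ij.1)) / 2 * A ij
      = (A ij * B ij) / 2 + (A ij * B (ij.2, ij.1)) / 2 := fun ij => by ring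
  simp only [e1, e2, Finset.sum_add_distrib, ← Finset.sum_div, h]

theorem symPart_symPart {d : ℕ} (A : Ten d) : symPart d (symPart d A) = symPart d A := by
  ext ij
  simp only [symPart_apply]
  ring

theorem inner_scalarTen {d : ℕ} (q : ℝ) (A : Ten d) :
    inner ℝ (scalarTen d q) A = inner ℝ q (tenTrace d A) := by
  simp only [PiLp.inner_apply, scalarTen_apply, tenTrace_apply, RCLike.inner_apply, conj_trivial,
    Fintype.sum_prod_type, mul_ite, mul_zero, Finset.sum_ite_eq, Finset.mem_univ, if_true,
    Finset.sum_mul]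

theorem inner_symGrad_left {d : ℕ} {Ω : Set (Vec d)} (G G' : L2Vol Ω (Ten d)) :
    inner ℝ (symGrad G) G' = inner ℝ G (symGrad G') :=
  inner_compLp _ _ inner_symPart G G'

theorem symGrad_symGrad {d : ℕ} {Ω : Set (Vec d)} (G : L2Vol Ω (Ten d)) :
    symGrad (symGrad G) = symGrad G := by
  refine Lp.ext ?_
  filter_upwards [(symPart d).coeFn_compLp (symGrad G), (symPart d).coeFn_compLp G] with x h1 h2
  rw [symGrad, h1, symGrad, h2, symPart_symPart]

/-- Taking the symmetric part is a self-adjoint idempotent, hence an orthogonal projection. -/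
theorem inner_symGrad_self {d : ℕ} {Ω : Set (Vec d)} (G : L2Vol Ω (Ten d)) :
    inner ℝ (symGrad G) G = ‖symGrad G‖ ^ 2 := by
  rw [← symGrad_symGrad G, inner_symGrad_left, symGrad_symGrad, real_inner_self_eq_norm_sq]

theorem inner_scalarTenL {d : ℕ} {Ω : Set (Vec d)} (q : L2Vol Ω ℝ) (G : L2Vol Ω (Ten d)) :
    inner ℝ (scalarTenL Ω q) G = inner ℝ q (divg G) :=
  inner_compLp _ _ inner_scalarTen q G

/-- The solid stress as a continuous linear map of the gradient. -/
noncomputable def solidStressL {d : ℕ} (Ω : Set (Vec d)) (L₁ L₂ : ℝ) :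
    L2Vol Ω (Ten d) →L[ℝ] L2Vol Ω (Ten d) :=
  (2 * L₁) • symGradL Ω + L₂ • (scalarTenL Ω).comp (divgL Ω)

theorem inner_solidStressL {d : ℕ} {Ω : Set (Vec d)} (L₁ L₂ : ℝ) (G G' : L2Vol Ω (Ten d)) :
    inner ℝ (solidStressL Ω L₁ L₂ G) G' =
      2 * L₁ * inner ℝ (symGrad G) G' + L₂ * inner ℝ (divg G) (divg G') := by
  change inner ℝ ((2 * L₁) • symGrad G + L₂ • scalarTenL Ω (divg G)) G' = _
  rw [inner_add_left, real_inner_smul_left, real_inner_smul_left, inner_scalarTenL]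

theorem solidStressL_symmetric {d : ℕ} {Ω : Set (Vec d)} (L₁ L₂ : ℝ) (G G' : L2Vol Ω (Ten d)) :
    inner ℝ (solidStressL Ω L₁ L₂ G) G' = inner ℝ G (solidStressL Ω L₁ L₂ G') := by
  rw [real_inner_comm _ G, inner_solidStressL, inner_solidStressL, inner_symGrad_left,
    real_inner_comm G, real_inner_comm (divg G)]

theorem inner_solidStressL_self {d : ℕ} {Ω : Set (Vec d)} (L₁ L₂ : ℝ) (G : L2Vol Ω (Ten d)) :
    inner ℝ (solidStressL Ω L₁ L₂ G) G = elasticNormSq L₁ L₂ G := by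
  rw [inner_solidStressL, inner_symGrad_self, real_inner_self_eq_norm_sq, elasticNormSq]

/-- The divergence-free fields of the energy space. -/
noncomputable def divFreeSubmodule {d : ℕ} (Ω Γ : Set (Vec d)) :
    Submodule ℝ (L2Vol Ω (Vec d) × L2Vol Ω (Ten d) × L2Surf Γ) :=
  energySubmodule Ω Γ ⊓ LinearMap.ker ((divgL Ω).comp
    ((ContinuousLinearMap.fst ℝ (L2Vol Ω (Ten d)) (L2Surf Γ)).comp
      (ContinuousLinearMap.snd ℝ (L2Vol Ω (Vec d)) (L2Vol Ω (Ten d) × L2Surf Γ)))).toLinearMap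

theorem mem_divFreeSubmodule {d : ℕ} {Ω Γ : Set (Vec d)}
    {z : L2Vol Ω (Vec d) × L2Vol Ω (Ten d) × L2Surf Γ} :
    z ∈ divFreeSubmodule Ω Γ ↔ z ∈ energySpace Ω Γ ∧ divg z.2.1 = 0 := by
  rw [divFreeSubmodule, Submodule.mem_inf, LinearMap.mem_ker, mem_energySubmodule]
  rfl

theorem isClosed_divFreeSubmodule {d : ℕ} (Ω Γ : Set (Vec d)) :
    IsClosed (divFreeSubmodule Ω Γ : Set (L2Vol Ω (Vec d) × L2Vol Ω (Ten d) × L2Surf Γ)) := by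
  rw [divFreeSubmodule, Submodule.coe_inf]
  exact (isClosed_energySubmodule Ω Γ).inter (ContinuousLinearMap.isClosed_ker _)

/-- The pressure does no work on divergence-free fields. What remains of the stress is square
integrable in time, as the energy identity requires. -/
theorem inner_fluidStress_of_divg_eq_zero {d : ℕ} {Ω : Set (Vec d)} (μ : ℝ)
    (G G' : L2Vol Ω (Ten d)) (p : L2Vol Ω ℝ) (h : divg G' = 0) :
    inner ℝ (fluidStress μ G p) G' = inner ℝ ((2 * μ) • symGradL Ω G) G' := by
  change inner ℝ ((2 * μ) • symGradL Ω G - scalarTenL Ω p) G' = _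
  rw [inner_sub_left, inner_scalarTenL, h, inner_zero_right, sub_zero]

/-! ## Energy identities for differences of solutions -/

theorem L2Time.mono {X : Type} [NormedAddCommGroup X] {a b a' b' : ℝ} {f : ℝ → X}
    (hf : L2Time a b f) (h : Icc a' b' ⊆ Icc a b) : L2Time a' b' f :=
  MemLp.mono_measure (Measure.restrict_mono h le_rfl) hf

theorem L2Time.sub {X : Type} [NormedAddCommGroup X] {a b : ℝ} {f g : ℝ → X}
    (hf : L2Time a b f) (hg : L2Time a b g) : L2Time a b (f - g) :=
  MemLp.sub hf hg

theorem L2Time.clm {X Y : Type} [NormedAddCommGroup X] [NormedSpace ℝ X] [NormedAddCommGroup Y]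
    [NormedSpace ℝ Y] {a b : ℝ} {f : ℝ → X} (L : X →L[ℝ] Y) (hf : L2Time a b f) :
    L2Time a b fun t => L (f t) :=
  L.comp_memLp' hf

theorem L2Time.of_continuousOn {X : Type} [NormedAddCommGroup X] {a b : ℝ} {f : ℝ → X}
    (hf : ContinuousOn f (Icc a b)) : L2Time a b f := by
  obtain ⟨C, hC⟩ := isCompact_Icc.exists_bound_of_continuousOn hf
  refine MemLp.of_bound (hf.aestronglyMeasurable_of_isCompact isCompact_Icc measurableSet_Icc) C ?_
  filter_upwards [ae_restrict_mem measurableSet_Icc] with x hx using hC x hx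

theorem L2Time.integrableOn {X : Type} [NormedAddCommGroup X] {a b : ℝ} {f : ℝ → X}
    (hf : L2Time a b f) : IntegrableOn f (Icc a b) :=
  MemLp.integrable (by norm_num) hf

theorem intervalIntegrable_of_integrableOn_Icc {X : Type} [NormedAddCommGroup X]
    {a b s t : ℝ} {f : ℝ → X} (hf : IntegrableOn f (Icc a b)) (hs : s ∈ Icc a b)
    (ht : t ∈ Icc a b) : IntervalIntegrable f volume s t :=
  (hf.mono_set (uIcc_subset_Icc hs ht)).intervalIntegrable

theorem HasTimeDeriv.sub_eq {X : Type} [NormedAddCommGroup X] [NormedSpace ℝ X] {a b : ℝ}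
    {f f' : ℝ → X} (h : HasTimeDeriv a b f f') {s t : ℝ} (hs : s ∈ Icc a b) (ht : t ∈ Icc a b) :
    f t - f s = ∫ τ in s..t, f' τ := by
  have ha : a ∈ Icc a b := ⟨le_rfl, hs.1.trans hs.2⟩
  rw [h.2 t ht, h.2 s hs, add_sub_add_left_eq_sub, intervalIntegral.integral_interval_sub_left
    (intervalIntegrable_of_integrableOn_Icc h.1 ha ht)
    (intervalIntegrable_of_integrableOn_Icc h.1 ha hs)]

/-- The weak formulation of the Stokes problem for divergence-free test fields: the pressure drops
out, and the formulation is linear. -/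
structure IsWeakStokes {d : ℕ} {Ω Γ : Set (Vec d)} (ρ μ a b : ℝ) (w : FluidHistory Ω Γ) :
    Prop where
  vel_continuous : ContinuousOn w.vel (Icc a b)
  mem : ∀ᵐ t ∂((volume : Measure ℝ).restrict (Icc a b)),
    (w.vel t, w.grad t, w.velTrace t) ∈ divFreeSubmodule Ω Γ
  grad_L2 : L2Time a b w.grad
  velTrace_L2 : L2Time a b w.velTrace
  normalStress_L2 : L2Time a b w.normalStress
  momentum : ∀ v ∈ divFreeSubmodule Ω Γ, ∀ s ∈ Icc a b, ∀ t ∈ Icc a b,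
    ρ * inner ℝ (w.vel t - w.vel s) v.1 =
      ∫ τ in s..t, (inner ℝ (w.normalStress τ) v.2.2
        - inner ℝ ((2 * μ) • symGradL Ω (w.grad τ)) v.2.1)

theorem integrableOn_momentum {G Z : Type} [NormedAddCommGroup G] [InnerProductSpace ℝ G]
    [NormedAddCommGroup Z] [InnerProductSpace ℝ Z] {a b : ℝ} {g : ℝ → Z} {F : ℝ → G}
    (hg : L2Time a b g) (hF : L2Time a b F) (z : Z) (y : G) :
    IntegrableOn (fun τ => inner ℝ (g τ) z - inner ℝ (F τ) y) (Icc a b) :=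
  (hg.integrableOn.inner_const z).sub (hF.integrableOn.inner_const y)

/-- Difference of two balances started at `a`. Averaging over `[s, s + h]`, and restricting the
exact solution to one time step, require an arbitrary starting time. -/
theorem momentum_of_start {H G Z : Type} [NormedAddCommGroup H] [InnerProductSpace ℝ H]
    [NormedAddCommGroup G] [InnerProductSpace ℝ G]
    [NormedAddCommGroup Z] [InnerProductSpace ℝ Z] {ρ a b : ℝ} {x : ℝ → H} {g : ℝ → Z} {F : ℝ → G}
    (hg : L2Time a b g) (hF : L2Time a b F) {v : H × G × Z}
    (h : ∀ t ∈ Icc a b, ρ * inner ℝ (x t - x a) v.1 =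
      ∫ τ in a..t, (inner ℝ (g τ) v.2.2 - inner ℝ (F τ) v.2.1))
    {s t : ℝ} (hs : s ∈ Icc a b) (ht : t ∈ Icc a b) :
    ρ * inner ℝ (x t - x s) v.1 =
      ∫ τ in s..t, (inner ℝ (g τ) v.2.2 - inner ℝ (F τ) v.2.1) := by
  have ha : a ∈ Icc a b := ⟨le_rfl, hs.1.trans hs.2⟩
  have hi := integrableOn_momentum hg hF v.2.2 v.2.1
  rw [← intervalIntegral.integral_interval_sub_left
    (intervalIntegrable_of_integrableOn_Icc hi ha ht)
    (intervalIntegrable_of_integrableOn_Icc hi ha hs), ← h t ht, ← h s hs, ← mul_sub,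
    ← inner_sub_left, sub_sub_sub_cancel_right]

theorem IsFluidSolution.isWeakStokes {d : ℕ} {Ω Γ : Set (Vec d)} {ρ μ a b : ℝ}
    {w : FluidHistory Ω Γ} (h : IsFluidSolution ρ μ a b w) : IsWeakStokes ρ μ a b w where
  vel_continuous := h.vel_continuous
  mem := by
    filter_upwards [h.mem_energySpace, h.div_eq_zero] with t h1 h2
    exact mem_divFreeSubmodule.2 ⟨h1, h2⟩
  grad_L2 := h.grad_L2
  velTrace_L2 := h.velTrace_L2
  normalStress_L2 := h.normalStress_L2
  momentum := by
    intro v hv s hs t ht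
    obtain ⟨hv1, hv2⟩ := mem_divFreeSubmodule.1 hv
    refine momentum_of_start (v := v) h.normalStress_L2
      (h.grad_L2.clm ((2 * μ) • symGradL Ω)) (fun t ht => ?_) hs ht
    rw [h.momentum v hv1 t ht]
    simp only [inner_fluidStress_of_divg_eq_zero _ _ _ _ hv2]
    rfl

theorem IsWeakStokes.mono {d : ℕ} {Ω Γ : Set (Vec d)} {ρ μ a b a' b' : ℝ}
    {w : FluidHistory Ω Γ} (h : IsWeakStokes ρ μ a b w) (hs : Icc a' b' ⊆ Icc a b) :
    IsWeakStokes ρ μ a' b' w where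
  vel_continuous := h.vel_continuous.mono hs
  mem := ae_mono (Measure.restrict_mono hs le_rfl) h.mem
  grad_L2 := h.grad_L2.mono hs
  velTrace_L2 := h.velTrace_L2.mono hs
  normalStress_L2 := h.normalStress_L2.mono hs
  momentum := fun v hv s hs' t ht => h.momentum v hv s (hs hs') t (hs ht)

theorem momentum_sub {H G Z : Type} [NormedAddCommGroup H] [InnerProductSpace ℝ H]
    [NormedAddCommGroup G] [InnerProductSpace ℝ G]
    [NormedAddCommGroup Z] [InnerProductSpace ℝ Z] {ρ a b : ℝ} {x x' : ℝ → H} {g g' : ℝ → Z}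
    {F F' : ℝ → G} (hg : L2Time a b g) (hF : L2Time a b F) (hg' : L2Time a b g')
    (hF' : L2Time a b F') (v : H × G × Z) {s t : ℝ} (hs : s ∈ Icc a b) (ht : t ∈ Icc a b)
    (h : ρ * inner ℝ (x t - x s) v.1 =
      ∫ τ in s..t, (inner ℝ (g τ) v.2.2 - inner ℝ (F τ) v.2.1))
    (h' : ρ * inner ℝ (x' t - x' s) v.1 =
      ∫ τ in s..t, (inner ℝ (g' τ) v.2.2 - inner ℝ (F' τ) v.2.1)) :
    ρ * inner ℝ ((x t - x' t) - (x s - x' s)) v.1 =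
      ∫ τ in s..t, (inner ℝ (g τ - g' τ) v.2.2 - inner ℝ (F τ - F' τ) v.2.1) := by
  have hi := intervalIntegrable_of_integrableOn_Icc
    (integrableOn_momentum hg hF v.2.2 v.2.1) hs ht
  have hi' := intervalIntegrable_of_integrableOn_Icc
    (integrableOn_momentum hg' hF' v.2.2 v.2.1) hs ht
  rw [sub_sub_sub_comm, inner_sub_left, mul_sub, h, h', ← intervalIntegral.integral_sub hi hi']
  congr 1
  funext τ
  rw [inner_sub_left, inner_sub_left]
  ring

/-- By linearity the error is again a weak solution, so the energy identity applies to it directly.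
-/
theorem IsWeakStokes.sub {d : ℕ} {Ω Γ : Set (Vec d)} {ρ μ a b : ℝ}
    {w z : FluidHistory Ω Γ} (hw : IsWeakStokes ρ μ a b w) (hz : IsWeakStokes ρ μ a b z) :
    IsWeakStokes ρ μ a b (w - z) where
  vel_continuous := hw.vel_continuous.sub hz.vel_continuous
  mem := by
    filter_upwards [hw.mem, hz.mem] with t h1 h2
    exact (divFreeSubmodule Ω Γ).sub_mem h1 h2
  grad_L2 := hw.grad_L2.sub hz.grad_L2
  velTrace_L2 := hw.velTrace_L2.sub hz.velTrace_L2
  normalStress_L2 := hw.normalStress_L2.sub hz.normalStress_L2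
  momentum := by
    intro v hv s hs t ht
    have := momentum_sub hw.normalStress_L2 (hw.grad_L2.clm ((2 * μ) • symGradL Ω))
      hz.normalStress_L2 (hz.grad_L2.clm ((2 * μ) • symGradL Ω)) v hs ht
      (hw.momentum v hv s hs t ht) (hz.momentum v hv s hs t ht)
    simp only [← map_sub] at this
    exact this

theorem IsWeakStokes.energy {d : ℕ} {Ω Γ : Set (Vec d)} {ρ μ a b : ℝ} (hab : a < b)
    {w : FluidHistory Ω Γ} (h : IsWeakStokes ρ μ a b w) :
    ρ / 2 * ‖w.vel b‖ ^ 2 - ρ / 2 * ‖w.vel a‖ ^ 2 =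
      (∫ s in a..b, inner ℝ (w.normalStress s) (w.velTrace s))
        - 2 * μ * ∫ s in a..b, ‖symGrad (w.grad s)‖ ^ 2 := by
  rw [parabolic_energy (isClosed_divFreeSubmodule Ω Γ) hab h.vel_continuous h.grad_L2
    (h.grad_L2.clm ((2 * μ) • symGradL Ω)) h.velTrace_L2 h.normalStress_L2 h.mem h.momentum,
    ← intervalIntegral.integral_const_mul]
  congr 2
  funext s
  change inner ℝ ((2 * μ) • symGrad (w.grad s)) (w.grad s) = _
  rw [real_inner_smul_left, inner_symGrad_self]

/-- The weak formulation of the elasticity problem, with the balances stated between any two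
times. -/
structure IsWeakElastic {d : ℕ} {Ω Γ : Set (Vec d)} (ρ L₁ L₂ a b : ℝ) (w : SolidHistory Ω Γ) :
    Prop where
  mem : ∀ t ∈ Icc a b, (w.disp t, w.grad t, w.dispTrace t) ∈ energySubmodule Ω Γ
  grad_continuous : ContinuousOn w.grad (Icc a b)
  vel_continuous : ContinuousOn w.vel (Icc a b)
  disp_deriv : ∀ s ∈ Icc a b, ∀ t ∈ Icc a b, w.disp t - w.disp s = ∫ τ in s..t, w.vel τ
  velTrace_L2 : L2Time a b w.velTrace
  dispTrace_deriv : ∀ s ∈ Icc a b, ∀ t ∈ Icc a b,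
    w.dispTrace t - w.dispTrace s = ∫ τ in s..t, w.velTrace τ
  normalStress_L2 : L2Time a b w.normalStress
  momentum : ∀ v ∈ energySubmodule Ω Γ, ∀ s ∈ Icc a b, ∀ t ∈ Icc a b,
    ρ * inner ℝ (w.vel t - w.vel s) v.1 =
      ∫ τ in s..t, (inner ℝ (w.normalStress τ) v.2.2
        - inner ℝ (solidStressL Ω L₁ L₂ (w.grad τ)) v.2.1)

theorem IsSolidSolution.isWeakElastic {d : ℕ} {Ω Γ : Set (Vec d)} {ρ L₁ L₂ a b : ℝ}
    {w : SolidHistory Ω Γ} (h : IsSolidSolution ρ L₁ L₂ a b w) :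
    IsWeakElastic ρ L₁ L₂ a b w where
  mem := fun t ht => mem_energySubmodule.2 (h.mem_energySpace t ht)
  grad_continuous := h.disp_continuous.snd
  vel_continuous := h.vel_continuous
  disp_deriv := fun _ hs _ ht => h.disp_deriv.sub_eq hs ht
  velTrace_L2 := h.velTrace_L2
  dispTrace_deriv := fun _ hs _ ht => h.dispTrace_deriv.sub_eq hs ht
  normalStress_L2 := h.normalStress_L2
  momentum := fun v hv _ hs _ ht =>
    momentum_of_start (v := v) h.normalStress_L2
      ((L2Time.of_continuousOn h.disp_continuous.snd).clm (solidStressL Ω L₁ L₂))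
      (h.momentum v (mem_energySubmodule.1 hv)) hs ht

theorem IsWeakElastic.mono {d : ℕ} {Ω Γ : Set (Vec d)} {ρ L₁ L₂ a b a' b' : ℝ}
    {w : SolidHistory Ω Γ} (h : IsWeakElastic ρ L₁ L₂ a b w) (hs : Icc a' b' ⊆ Icc a b) :
    IsWeakElastic ρ L₁ L₂ a' b' w where
  mem := fun t ht => h.mem t (hs ht)
  grad_continuous := h.grad_continuous.mono hs
  vel_continuous := h.vel_continuous.mono hs
  disp_deriv := fun s hs' t ht => h.disp_deriv s (hs hs') t (hs ht)
  velTrace_L2 := h.velTrace_L2.mono hs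
  dispTrace_deriv := fun s hs' t ht => h.dispTrace_deriv s (hs hs') t (hs ht)
  normalStress_L2 := h.normalStress_L2.mono hs
  momentum := fun v hv s hs' t ht => h.momentum v hv s (hs hs') t (hs ht)

theorem IsWeakElastic.sub {d : ℕ} {Ω Γ : Set (Vec d)} {ρ L₁ L₂ a b : ℝ}
    {w z : SolidHistory Ω Γ} (hw : IsWeakElastic ρ L₁ L₂ a b w)
    (hz : IsWeakElastic ρ L₁ L₂ a b z) : IsWeakElastic ρ L₁ L₂ a b (w - z) where
  mem := fun t ht => (energySubmodule Ω Γ).sub_mem (hw.mem t ht) (hz.mem t ht)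
  grad_continuous := hw.grad_continuous.sub hz.grad_continuous
  vel_continuous := hw.vel_continuous.sub hz.vel_continuous
  disp_deriv := fun s hs t ht => by
    have h1 := intervalIntegral.integral_sub
      (intervalIntegrable_of_integrableOn_Icc
        (L2Time.of_continuousOn hw.vel_continuous).integrableOn hs ht)
      (intervalIntegrable_of_integrableOn_Icc
        (L2Time.of_continuousOn hz.vel_continuous).integrableOn hs ht)
    rw [← hw.disp_deriv s hs t ht, ← hz.disp_deriv s hs t ht, ← sub_sub_sub_comm] at h1
    exact h1.symm
  velTrace_L2 := hw.velTrace_L2.sub hz.velTrace_L2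
  dispTrace_deriv := fun s hs t ht => by
    have h1 := intervalIntegral.integral_sub
      (intervalIntegrable_of_integrableOn_Icc hw.velTrace_L2.integrableOn hs ht)
      (intervalIntegrable_of_integrableOn_Icc hz.velTrace_L2.integrableOn hs ht)
    rw [← hw.dispTrace_deriv s hs t ht, ← hz.dispTrace_deriv s hs t ht,
      ← sub_sub_sub_comm] at h1
    exact h1.symm
  normalStress_L2 := hw.normalStress_L2.sub hz.normalStress_L2
  momentum := fun v hv s hs t ht => by
    have := momentum_sub hw.normalStress_L2
      ((L2Time.of_continuousOn hw.grad_continuous).clm (solidStressL Ω L₁ L₂))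
      hz.normalStress_L2 ((L2Time.of_continuousOn hz.grad_continuous).clm (solidStressL Ω L₁ L₂))
      v hs ht (hw.momentum v hv s hs t ht) (hz.momentum v hv s hs t ht)
    simp only [← map_sub] at this
    exact this

theorem IsWeakElastic.energy {d : ℕ} {Ω Γ : Set (Vec d)} {ρ L₁ L₂ a b : ℝ} (hab : a < b)
    {w : SolidHistory Ω Γ} (h : IsWeakElastic ρ L₁ L₂ a b w) :
    (ρ / 2 * ‖w.vel b‖ ^ 2 + 1 / 2 * elasticNormSq L₁ L₂ (w.grad b))
      - (ρ / 2 * ‖w.vel a‖ ^ 2 + 1 / 2 * elasticNormSq L₁ L₂ (w.grad a)) =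
      ∫ s in a..b, inner ℝ (w.normalStress s) (w.velTrace s) := by
  rw [← hyperbolic_energy hab (solidStressL Ω L₁ L₂) (solidStressL_symmetric L₁ L₂)
    h.vel_continuous h.grad_continuous h.velTrace_L2 h.normalStress_L2 h.mem h.disp_deriv
    h.dispTrace_deriv h.momentum, inner_solidStressL_self, inner_solidStressL_self]

/-- The displacement determines its gradient. -/
theorem energySpace_grad_unique {d : ℕ} {Ω Γ : Set (Vec d)} (hΩ : IsLipschitzDomain Ω)
    {v v' : L2Vol Ω (Vec d)} {G G' : L2Vol Ω (Ten d)} {y y' : L2Surf Γ}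
    (hz : (v, G, y) ∈ energySpace Ω Γ) (hz' : (v', G', y') ∈ energySpace Ω Γ) (hv : v = v') :
    G = G' := by
  subst hv
  exact sobolevGraph_grad_unique hΩ.isOpen hΩ.isBounded hz.1 hz'.1

/-! ## The interface terms -/

theorem inner_le_young {Z : Type} [NormedAddCommGroup Z] [InnerProductSpace ℝ Z] {c : ℝ}
    (hc : 0 < c) (x y : Z) : inner ℝ x y ≤ c / 2 * ‖x‖ ^ 2 + 1 / (2 * c) * ‖y‖ ^ 2 := by
  have h1 := real_inner_le_norm x y
  have h2 : c / 2 * ‖x‖ ^ 2 + 1 / (2 * c) * ‖y‖ ^ 2 - ‖x‖ * ‖y‖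
      = 1 / (2 * c) * (c * ‖x‖ - ‖y‖) ^ 2 := by
    field_simp
    ring
  have h3 : 0 ≤ 1 / (2 * c) * (c * ‖x‖ - ‖y‖) ^ 2 := by positivity
  linarith

/-- The power of the interface forces under perturbed Robin conditions. -/
theorem robin_power_eq {Z : Type} [NormedAddCommGroup Z] [InnerProductSpace ℝ Z] {lam : ℝ}
    (hl : lam ≠ 0) {s g : Z} (a b β γ r q : Z) (hs : s = lam • (β - a) - γ + lam • r - q)
    (hg : g = lam • (a - b) + γ + q) :
    inner ℝ s a + inner ℝ g b = lam / 2 * (‖β‖ ^ 2 - ‖b‖ ^ 2)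
      + 1 / (2 * lam) * (‖γ + q‖ ^ 2 - ‖g‖ ^ 2) - lam / 2 * ‖a - β‖ ^ 2 + lam * inner ℝ r a := by
  -- The solid condition produces `-lam / 2 * ‖a‖ ^ 2` and the fluid condition the opposite term;
  -- their cancellation is what makes the scheme stable.
  subst hs hg
  simp only [← real_inner_self_eq_norm_sq, inner_add_left, inner_add_right, inner_sub_left,
    inner_sub_right, real_inner_smul_left, real_inner_smul_right]
  rw [real_inner_comm a b, real_inner_comm a β, real_inner_comm a γ, real_inner_comm a q,
    real_inner_comm b γ, real_inner_comm b q, real_inner_comm γ q]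
  field_simp
  ring

/-- Young's inequality with weight `κ` treats `⟪γ, q⟫` and `⟪r, β⟫`: the old data gain the factor `1
+ κ`, the lag errors `1 + 1 / κ`. In `⟪r, a⟫ = ⟪r, a - β⟫ + ⟪r, β⟫` the first term uses up half of
`lam / 2 * ‖a - β‖ ^ 2`, whence the `lam / 4` in the dissipation. -/
theorem robin_power_le {Z : Type} [NormedAddCommGroup Z] [InnerProductSpace ℝ Z] {lam κ : ℝ}
    (hl : 0 < lam) (hκ : 0 < κ) {s g : Z} (a b β γ r q : Z)
    (hs : s = lam • (β - a) - γ + lam • r - q) (hg : g = lam • (a - b) + γ + q) :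
    inner ℝ s a + inner ℝ g b ≤
      ((1 + κ) * (lam / 2 * ‖β‖ ^ 2 + 1 / (2 * lam) * ‖γ‖ ^ 2)
        + (1 + 1 / κ) * (lam * ‖r‖ ^ 2 + 1 / lam * ‖q‖ ^ 2))
      - (lam / 2 * ‖b‖ ^ 2 + 1 / (2 * lam) * ‖g‖ ^ 2 + lam / 4 * ‖a - β‖ ^ 2) := by
  rw [robin_power_eq hl.ne' a b β γ r q hs hg]
  have h1 : ‖γ + q‖ ^ 2 ≤ (1 + κ) * ‖γ‖ ^ 2 + (1 + 1 / κ) * ‖q‖ ^ 2 := by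
    rw [norm_add_sq_real]
    have := inner_le_young hκ γ q
    have e : 2 * (1 / (2 * κ)) = 1 / κ := by field_simp
    nlinarith
  have h2 : inner ℝ r a ≤ 1 / 4 * ‖a - β‖ ^ 2 + ‖r‖ ^ 2 + κ / 2 * ‖β‖ ^ 2
      + 1 / (2 * κ) * ‖r‖ ^ 2 := by
    have e : inner ℝ r a = inner ℝ (a - β) r + inner ℝ β r := by
      rw [← inner_add_left, sub_add_cancel, real_inner_comm]
    have y1 := inner_le_young (c := 1 / 2) (by norm_num) (a - β) r
    have y2 := inner_le_young hκ β r
    rw [e]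
    norm_num at y1
    linarith
  have h3 := mul_le_mul_of_nonneg_left h1 (by positivity : 0 ≤ 1 / (2 * lam))
  have h4 := mul_le_mul_of_nonneg_left h2 hl.le
  have h5 : 0 ≤ lam * (1 / (2 * κ)) * ‖r‖ ^ 2 := by positivity
  have h6 : 0 ≤ 1 / (2 * lam) * ((1 + 1 / κ) * ‖q‖ ^ 2) := by positivity
  have e1 : 1 / κ = 2 * (1 / (2 * κ)) := by field_simp
  have e2 : 1 / lam = 2 * (1 / (2 * lam)) := by field_simp
  rw [e2]
  rw [e1] at h3 h6 ⊢
  linarith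

/-! ## Time averages -/

theorem L2Time.norm_sq_integrableOn {X : Type} [NormedAddCommGroup X] {a b : ℝ} {f : ℝ → X}
    (hf : L2Time a b f) : IntegrableOn (fun t => ‖f t‖ ^ 2) (Icc a b) :=
  (memLp_two_iff_integrable_sq_norm hf.1).1 hf

theorem L2Time.norm_sq_intervalIntegrable {X : Type} [NormedAddCommGroup X] {a b : ℝ} {f : ℝ → X}
    (hf : L2Time a b f) {s t : ℝ} (hs : s ∈ Icc a b) (ht : t ∈ Icc a b) :
    IntervalIntegrable (fun t => ‖f t‖ ^ 2) volume s t :=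
  intervalIntegrable_of_integrableOn_Icc hf.norm_sq_integrableOn hs ht

theorem norm_integral_sq_le {X : Type} [NormedAddCommGroup X] [NormedSpace ℝ X] {a b : ℝ}
    (hab : a ≤ b) {f : ℝ → X} (hf : L2Time a b f) :
    ‖∫ t in a..b, f t‖ ^ 2 ≤ (b - a) * ∫ t in a..b, ‖f t‖ ^ 2 := by
  have hi := hf.norm_sq_integrableOn.mono_set Ioc_subset_Icc_self
  have h := enorm_integral_sq_le hab (f := f)
    (hf.1.mono_measure (Measure.restrict_mono Ioc_subset_Icc_self le_rfl))
  have e : ∫⁻ x in Ioc a b, ‖f x‖ₑ ^ 2 = ENNReal.ofReal (∫ t in a..b, ‖f t‖ ^ 2) := by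
    rw [intervalIntegral.integral_of_le hab,
      ofReal_integral_eq_lintegral_ofReal hi (.of_forall fun t => by positivity)]
    refine lintegral_congr fun x => ?_
    rw [← ofReal_norm, ENNReal.ofReal_pow (norm_nonneg _)]
  rw [e, ← ofReal_norm, ← ENNReal.ofReal_pow (norm_nonneg _),
    ← ENNReal.ofReal_mul (by linarith)] at h
  refine (ENNReal.ofReal_le_ofReal_iff ?_).1 h
  exact mul_nonneg (by linarith) (intervalIntegral.integral_nonneg hab fun t _ => by positivity)

/-- At index 0 there is no preceding step: both histories start from `W 0`, so the lagged error
starts from 0, and integrability matters only for successors. -/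
theorem lagged_sub {X : Type} [NormedAddCommGroup X] [NormedSpace ℝ X] (Δt : ℝ) (W : ℝ → X)
    (x : ℕ → ℝ → X) (m : ℕ)
    (hW : ∀ n, m = n + 1 → IntervalIntegrable W volume (n * Δt) ((n + 1 : ℕ) * Δt))
    (hx : ∀ n, m = n + 1 → IntervalIntegrable (x m) volume (n * Δt) ((n + 1 : ℕ) * Δt)) :
    lagged Δt 0 (fun n => W - x n) m
      = lagged Δt (W 0) (fun _ => W) m - lagged Δt (W 0) x m := by
  cases m with
  | zero => simp [lagged]
  | succ n =>
    simp only [lagged, Pi.sub_apply]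
    rw [intervalIntegral.integral_sub (hW n rfl) (hx n rfl), smul_sub]

/-- Cauchy–Schwarz: averaging is a contraction in L². This bounds the lagged Robin data by the
interface error of the previous step. -/
theorem norm_lagged_sq_le {X : Type} [NormedAddCommGroup X] [NormedSpace ℝ X] {Δt : ℝ}
    (hΔ : 0 < Δt) (x₀ : X) (x : ℕ → ℝ → X) (n : ℕ)
    (hx : L2Time (n * Δt) ((n + 1 : ℕ) * Δt) (x (n + 1))) :
    Δt * ‖lagged Δt x₀ x (n + 1)‖ ^ 2
      ≤ ∫ s in (n * Δt : ℝ)..((n + 1 : ℕ) * Δt : ℝ), ‖x (n + 1) s‖ ^ 2 := by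
  have hle : (n * Δt : ℝ) ≤ (n + 1 : ℕ) * Δt := by push_cast; linarith
  have h := norm_integral_sq_le hle hx
  have e : ((n + 1 : ℕ) * Δt - n * Δt : ℝ) = Δt := by push_cast; ring
  rw [e] at h
  rw [lagged, norm_smul, mul_pow, Real.norm_of_nonneg (by positivity)]
  calc Δt * (Δt⁻¹ ^ 2 * ‖∫ s in (n * Δt : ℝ)..((n + 1 : ℕ) * Δt : ℝ), x (n + 1) s‖ ^ 2)
      ≤ Δt * (Δt⁻¹ ^ 2 * (Δt * ∫ s in (n * Δt : ℝ)..((n + 1 : ℕ) * Δt : ℝ),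
          ‖x (n + 1) s‖ ^ 2)) := by gcongr
    _ = _ := by field_simp

/-- The lag error of a function with a square integrable time derivative. -/
theorem norm_sub_lagged_sq_le {X : Type} [NormedAddCommGroup X] [NormedSpace ℝ X]
    [CompleteSpace X] {Δt T : ℝ} (hΔ : 0 < Δt) {W dW : ℝ → X} (hW : HasTimeDeriv 0 T W dW)
    (hdW : L2Time 0 T dW) {m : ℕ} (hm : (m + 1 : ℕ) * Δt ≤ T) {t : ℝ}
    (ht : t ∈ Icc (m * Δt) ((m + 1 : ℕ) * Δt)) :
    ‖W t - lagged Δt (W 0) (fun _ => W) m‖ ^ 2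
      ≤ 2 * Δt * ∫ s in ((m - 1 : ℕ) * Δt : ℝ)..((m + 1 : ℕ) * Δt : ℝ), ‖dW s‖ ^ 2 := by
  -- The interval `[p, c]` covers the current step and the one averaged over. Truncated subtraction
  -- gives `p = 0` for `m = 0`, where the lagged value is `W 0`.
  set p : ℝ := (m - 1 : ℕ) * Δt with hp
  set c : ℝ := (m + 1 : ℕ) * Δt with hc
  have hp0 : 0 ≤ p := by positivity
  have hpm : p ≤ m * Δt := by
    rw [hp]; gcongr; exact Nat.sub_le m 1
  have hcp : c - p ≤ 2 * Δt := by
    have : (m : ℝ) ≤ (m - 1 : ℕ) + 1 := by exact_mod_cast Nat.le_add_of_sub_le le_rfl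
    rw [hc, hp, ← sub_mul]
    push_cast
    gcongr
    linarith
  have hpc : p ≤ c := hpm.trans (ht.1.trans ht.2)
  have hsub : ∀ τ ∈ Icc p c, τ ∈ Icc 0 T := fun τ hτ => ⟨hp0.trans hτ.1, hτ.2.trans hm⟩
  have hpI : p ∈ Icc 0 T := hsub p ⟨le_rfl, hpc⟩
  have hcI : c ∈ Icc 0 T := hsub c ⟨hpc, le_rfl⟩
  have htI : t ∈ Icc p c := ⟨hpm.trans ht.1, ht.2⟩
  have hR0 : 0 ≤ 2 * Δt * ∫ s in p..c, ‖dW s‖ ^ 2 :=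
    mul_nonneg (by positivity) (intervalIntegral.integral_nonneg hpc fun s _ => by positivity)
  have hord : ∀ σ τ, σ ∈ Icc p c → τ ∈ Icc p c → σ ≤ τ →
      ‖W τ - W σ‖ ^ 2 ≤ 2 * Δt * ∫ s in p..c, ‖dW s‖ ^ 2 := by
    intro σ τ hσ hτ hστ
    rw [hW.sub_eq (hsub σ hσ) (hsub τ hτ)]
    have hI : ∫ s in σ..τ, ‖dW s‖ ^ 2 ≤ ∫ s in p..c, ‖dW s‖ ^ 2 :=
      intervalIntegral.integral_mono_interval hσ.1 hστ hτ.2 (.of_forall fun s => by positivity)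
        (hdW.norm_sq_intervalIntegrable hpI hcI)
    refine (norm_integral_sq_le hστ (hdW.mono (Icc_subset_Icc (hp0.trans hσ.1)
      (hτ.2.trans hm)))).trans (mul_le_mul ?_ hI
        (intervalIntegral.integral_nonneg hστ fun s _ => by positivity) (by positivity))
    linarith [hσ.1, hτ.2]
  -- Bounding the distance to every single value, not its square, lets the bound pass to the
  -- average.
  have hdist : ∀ σ ∈ Icc p c, ‖W t - W σ‖ ≤ √(2 * Δt * ∫ s in p..c, ‖dW s‖ ^ 2) := by
    intro σ hσ
    refine Real.le_sqrt_of_sq_le ?_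
    rcases le_total σ t with h | h
    · exact hord σ t hσ htI h
    · rw [norm_sub_rev]
      exact hord t σ htI hσ h
  suffices h : ‖W t - lagged Δt (W 0) (fun _ => W) m‖ ≤ √(2 * Δt * ∫ s in p..c, ‖dW s‖ ^ 2) by
    calc _ ≤ √(2 * Δt * ∫ s in p..c, ‖dW s‖ ^ 2) ^ 2 := by gcongr
      _ = _ := Real.sq_sqrt hR0
  cases m with
  | zero =>
    have : p = 0 := by simp [hp]
    exact hdist 0 (by rw [← this]; exact ⟨le_rfl, hpc⟩)
  | succ n =>
    have ep : p = n * Δt := by simp [hp]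
    have hq : ((n + 1 : ℕ) * Δt : ℝ) ∈ Icc p c := ⟨hpm, ht.1.trans ht.2⟩
    have eΔ : ((n + 1 : ℕ) * Δt - n * Δt : ℝ) = Δt := by push_cast; ring
    have hcW : ContinuousOn W (Icc 0 T) := by
      have h0 : (0 : ℝ) ≤ T := hpI.1.trans hpI.2
      have h1 := intervalIntegral.continuousOn_primitive_interval
        (μ := volume) (f := dW) (a := 0) (b := T) (by rw [uIcc_of_le h0]; exact hW.1)
      rw [uIcc_of_le h0] at h1
      exact (continuousOn_const.add h1).congr hW.2
    have hWi : IntervalIntegrable W volume (n * Δt) ((n + 1 : ℕ) * Δt) :=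
      intervalIntegrable_of_integrableOn_Icc (hcW.integrableOn_Icc) (ep ▸ hpI) (hsub _ hq)
    have e : W t - lagged Δt (W 0) (fun _ => W) (n + 1)
        = Δt⁻¹ • ∫ s in (n * Δt : ℝ)..((n + 1 : ℕ) * Δt : ℝ), (W t - W s) := by
      rw [intervalIntegral.integral_sub intervalIntegrable_const hWi,
        intervalIntegral.integral_const, eΔ, smul_sub, smul_smul, inv_mul_cancel₀ hΔ.ne', one_smul]
      rfl
    rw [e, norm_smul, Real.norm_of_nonneg (by positivity)]
    have hle : (n * Δt : ℝ) ≤ (n + 1 : ℕ) * Δt := by push_cast; linarith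
    have h2 := intervalIntegral.norm_integral_le_of_norm_le_const
      (f := fun s => W t - W s) (a := n * Δt) (b := (n + 1 : ℕ) * Δt)
      (C := √(2 * Δt * ∫ s in p..c, ‖dW s‖ ^ 2)) fun s hs => by
        rw [uIoc_of_le hle] at hs
        exact hdist s ⟨ep ▸ hs.1.le, hs.2.trans hq.2⟩
    rw [eΔ, abs_of_pos hΔ] at h2
    calc _ ≤ Δt⁻¹ * (√(2 * Δt * ∫ s in p..c, ‖dW s‖ ^ 2) * Δt) := by gcongr
      _ = _ := by field_simp

/-! ## Summation -/

/-- A discrete Gronwall argument in which only `Q` is amplified. The induction hypothesis is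
multiplied by `1 + κ`, and the surplus `κ * (E k + ∑ D)` is dropped as nonnegative. -/
theorem energy_recursion_le {E D Q R : ℕ → ℝ} {κ : ℝ} {N : ℕ} (hκ : 0 ≤ κ) (hE : ∀ n, 0 ≤ E n)
    (hD : ∀ n, 0 ≤ D n) (hR : ∀ n < N, 0 ≤ R n) (hE0 : E 0 = 0) (hQ0 : Q 0 = 0)
    (h : ∀ n < N, E (n + 1) + D n + Q (n + 1) ≤ E n + (1 + κ) * Q n + R n) :
    E N + ∑ m ∈ Finset.range N, D m + Q N ≤ (1 + κ) ^ N * ∑ m ∈ Finset.range N, R m := by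
  suffices H : ∀ k ≤ N, E k + ∑ m ∈ Finset.range k, D m + Q k
      ≤ (1 + κ) ^ k * ∑ m ∈ Finset.range k, R m from H N le_rfl
  intro k
  induction k with
  | zero => simp [hE0, hQ0]
  | succ k ih =>
    intro hk
    have h1 := ih (by omega)
    have h2 := h k (by omega)
    have h3 := hR k (by omega)
    have h4 : 0 ≤ ∑ m ∈ Finset.range k, D m := Finset.sum_nonneg fun m _ => hD m
    have h5 : 1 ≤ (1 + κ) ^ (k + 1) := one_le_pow₀ (by linarith)
    have h6 := mul_le_mul_of_nonneg_left h1 (by linarith : 0 ≤ 1 + κ)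
    have h7 : R k ≤ (1 + κ) ^ (k + 1) * R k := le_mul_of_one_le_left h3 h5
    have h8 : 0 ≤ κ * (E k + ∑ m ∈ Finset.range k, D m) := mul_nonneg hκ (add_nonneg (hE k) h4)
    rw [Finset.sum_range_succ, Finset.sum_range_succ, mul_add]
    rw [← mul_assoc, ← pow_succ'] at h6
    linarith

theorem sum_overlapping_integrals_le {f : ℝ → ℝ} (hf : ∀ s, 0 ≤ f s) {Δt : ℝ} (hΔ : 0 < Δt)
    {N : ℕ} (hi : IntegrableOn f (Icc 0 (N * Δt))) :
    ∑ m ∈ Finset.range N, ∫ s in ((m - 1 : ℕ) * Δt : ℝ)..((m + 1 : ℕ) * Δt : ℝ), f s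
      ≤ 2 * ∫ s in (0 : ℝ)..(N * Δt), f s := by
  have hI : ∀ k ≤ N, (k * Δt : ℝ) ∈ Icc (0 : ℝ) (N * Δt) := fun k hk =>
    ⟨by positivity, by gcongr⟩
  have h0 : (0 : ℝ) ∈ Icc (0 : ℝ) (N * Δt) := ⟨le_rfl, by positivity⟩
  -- The intervals cover each time step at most twice. The sum is exactly two integrals from 0,
  -- ending at the last and the last but one time level.
  have key : ∀ k ≤ N,
      ∑ m ∈ Finset.range k, ∫ s in ((m - 1 : ℕ) * Δt : ℝ)..((m + 1 : ℕ) * Δt : ℝ), f s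
        = (∫ s in (0 : ℝ)..(k * Δt), f s) + ∫ s in (0 : ℝ)..((k - 1 : ℕ) * Δt), f s := by
    intro k
    induction k with
    | zero => simp
    | succ k ih =>
      intro hk
      rw [Finset.sum_range_succ, ih (by omega), ← intervalIntegral.integral_interval_sub_left
        (intervalIntegrable_of_integrableOn_Icc hi h0 (hI (k + 1) hk))
        (intervalIntegrable_of_integrableOn_Icc hi h0 (hI (k - 1) (by omega))),
        Nat.add_sub_cancel]
      ring
  rw [key N le_rfl, two_mul]
  gcongr
  exact intervalIntegral.integral_mono_interval le_rfl (hI _ (Nat.sub_le N 1)).1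
    (hI _ (Nat.sub_le N 1)).2 (.of_forall hf)
    (intervalIntegrable_of_integrableOn_Icc hi h0 (hI N le_rfl))

theorem one_add_inv_pow_le_three {N : ℕ} (hN : 1 ≤ N) : (1 + 1 / (N : ℝ)) ^ N ≤ 3 := by
  have h0 : (0 : ℝ) < N := by exact_mod_cast hN
  calc (1 + 1 / (N : ℝ)) ^ N ≤ Real.exp (1 / N) ^ N := by
        gcongr
        linarith [Real.add_one_le_exp (1 / (N : ℝ))]
    _ = Real.exp 1 := by rw [← Real.exp_nat_mul]; congr 1; field_simp
    _ ≤ 3 := Real.exp_one_lt_three.le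

/-! ## One step of the splitting method, and the error estimate -/

/-- Sum of the fluid and solid energy identities, with the power estimated pointwise in time by
`robin_power_le` and then integrated; `Br` and `Bq` bound the lag errors uniformly on the step. -/
theorem robin_step_energy {d : ℕ} {Ωf Ωs Γ : Set (Vec d)} {ρf ρs μ L₁ L₂ lam κ a b Br Bq : ℝ}
    (hab : a < b) (hl : 0 < lam) (hκ : 0 < κ) {e : FluidHistory Ωf Γ} {z : SolidHistory Ωs Γ}
    (he : IsWeakStokes ρf μ a b e) (hz : IsWeakElastic ρs L₁ L₂ a b z) {β γ : L2Surf Γ}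
    {r q : ℝ → L2Surf Γ}
    (hzr : ∀ᵐ t ∂((volume : Measure ℝ).restrict (Icc a b)),
      z.normalStress t = lam • (β - z.velTrace t) - γ + lam • r t - q t)
    (her : ∀ᵐ t ∂((volume : Measure ℝ).restrict (Icc a b)),
      e.normalStress t = lam • (z.velTrace t - e.velTrace t) + γ + q t)
    (hr : ∀ t ∈ Icc a b, ‖r t‖ ^ 2 ≤ Br) (hq : ∀ t ∈ Icc a b, ‖q t‖ ^ 2 ≤ Bq) :
    energyError ρf ρs L₁ L₂ e z b + dissipationError μ lam a b e z β + interfaceError lam a b e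
      ≤ energyError ρf ρs L₁ L₂ e z a
        + (1 + κ) * ((b - a) * (lam / 2 * ‖β‖ ^ 2 + 1 / (2 * lam) * ‖γ‖ ^ 2))
        + (1 + 1 / κ) * ((b - a) * (lam * Br + 1 / lam * Bq)) := by
  have ha : a ∈ Icc a b := ⟨le_rfl, hab.le⟩
  have hb : b ∈ Icc a b := ⟨hab.le, le_rfl⟩
  have hii : ∀ {f : ℝ → ℝ}, IntegrableOn f (Icc a b) → IntervalIntegrable f volume a b :=
    fun hf => intervalIntegrable_of_integrableOn_Icc hf ha hb
  have i1 := hii (integrable_inner_of_memLp hz.normalStress_L2 hz.velTrace_L2)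
  have i2 := hii (integrable_inner_of_memLp he.normalStress_L2 he.velTrace_L2)
  have hdiff : L2Time a b fun t => z.velTrace t - β :=
    hz.velTrace_L2.sub (L2Time.of_continuousOn (f := fun _ => β) continuousOn_const)
  have i3 := he.velTrace_L2.norm_sq_intervalIntegrable ha hb
  have i4 := he.normalStress_L2.norm_sq_intervalIntegrable ha hb
  have i5 := hdiff.norm_sq_intervalIntegrable ha hb
  have key := intervalIntegral.integral_mono_ae_restrict hab.le (i1.add i2)
    ((intervalIntegrable_const (μ := volume) (a := a) (b := b)
      (c := (1 + κ) * (lam / 2 * ‖β‖ ^ 2 + 1 / (2 * lam) * ‖γ‖ ^ 2)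
        + (1 + 1 / κ) * (lam * Br + 1 / lam * Bq))).sub
      (((i3.const_mul (lam / 2)).add (i4.const_mul (1 / (2 * lam)))).add
        (i5.const_mul (lam / 4)))) (by
      filter_upwards [hzr, her, ae_restrict_mem measurableSet_Icc] with t h1 h2 ht
      refine (robin_power_le hl hκ _ _ β γ (r t) (q t) h1 h2).trans ?_
      have hr' := hr t ht
      have hq' := hq t ht
      gcongr)
  rw [intervalIntegral.integral_add i1 i2, intervalIntegral.integral_sub intervalIntegrable_const
    (((i3.const_mul (lam / 2)).add (i4.const_mul (1 / (2 * lam)))).add (i5.const_mul (lam / 4))),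
    intervalIntegral.integral_const, intervalIntegral.integral_add
    ((i3.const_mul (lam / 2)).add (i4.const_mul (1 / (2 * lam)))) (i5.const_mul (lam / 4)),
    intervalIntegral.integral_add (i3.const_mul (lam / 2)) (i4.const_mul (1 / (2 * lam))),
    intervalIntegral.integral_const_mul, intervalIntegral.integral_const_mul,
    intervalIntegral.integral_const_mul, ← hz.energy hab, smul_eq_mul] at key
  have hen := he.energy hab
  unfold energyError dissipationError interfaceError
  linarith

theorem energyError_nonneg {d : ℕ} {Ωf Ωs Γ : Set (Vec d)} {ρf ρs L₁ L₂ : ℝ} (h1 : 0 ≤ ρf)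
    (h2 : 0 ≤ ρs) (h3 : 0 ≤ L₁) (h4 : 0 ≤ L₂) (e : FluidHistory Ωf Γ) (z : SolidHistory Ωs Γ)
    (t : ℝ) : 0 ≤ energyError ρf ρs L₁ L₂ e z t := by
  unfold energyError elasticNormSq
  positivity

theorem dissipationError_nonneg {d : ℕ} {Ωf Ωs Γ : Set (Vec d)} {μ lam a b : ℝ} (hab : a ≤ b)
    (h1 : 0 ≤ μ) (h2 : 0 ≤ lam) (e : FluidHistory Ωf Γ) (z : SolidHistory Ωs Γ) (y : L2Surf Γ) :
    0 ≤ dissipationError μ lam a b e z y := by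
  unfold dissipationError
  have i1 : 0 ≤ ∫ s in a..b, ‖symGrad (e.grad s)‖ ^ 2 :=
    intervalIntegral.integral_nonneg hab fun s _ => by positivity
  have i2 : 0 ≤ ∫ s in a..b, ‖z.velTrace s - y‖ ^ 2 :=
    intervalIntegral.integral_nonneg hab fun s _ => by positivity
  positivity

theorem energyError_congr {d : ℕ} {Ωf Ωs Γ : Set (Vec d)} {ρf ρs L₁ L₂ t : ℝ}
    {e e' : FluidHistory Ωf Γ} {z z' : SolidHistory Ωs Γ} (h1 : e.vel t = e'.vel t)
    (h2 : z.vel t = z'.vel t) (h3 : z.grad t = z'.grad t) :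
    energyError ρf ρs L₁ L₂ e z t = energyError ρf ρs L₁ L₂ e' z' t := by
  rw [energyError, energyError, h1, h2, h3]

theorem energyError_eq_zero {d : ℕ} {Ωf Ωs Γ : Set (Vec d)} {ρf ρs L₁ L₂ t : ℝ}
    {e : FluidHistory Ωf Γ} {z : SolidHistory Ωs Γ} (h1 : e.vel t = 0)
    (h2 : z.vel t = 0) (h3 : z.grad t = 0) : energyError ρf ρs L₁ L₂ e z t = 0 := by
  have h4 : symGrad (0 : L2Vol Ωs (Ten d)) = 0 := (symGradL Ωs).map_zero
  have h5 : divg (0 : L2Vol Ωs (Ten d)) = 0 := (divgL Ωs).map_zero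
  simp [energyError, elasticNormSq, h1, h2, h3, h4, h5]

/-- The energy of the errors after `n` steps, `0` at the start. -/
noncomputable def energyAfter {d : ℕ} {Ωf Ωs Γ : Set (Vec d)} (ρf ρs L₁ L₂ Δt : ℝ)
    (U : FluidHistory Ωf Γ) (S : SolidHistory Ωs Γ) (u : ℕ → FluidHistory Ωf Γ)
    (η : ℕ → SolidHistory Ωs Γ) : ℕ → ℝ
  | 0 => 0
  | n + 1 => energyError ρf ρs L₁ L₂ (U - u (n + 1)) (S - η (n + 1)) ((n + 1 : ℕ) * Δt)

/-- The interface error of step `n`, `0` at the start. -/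
noncomputable def interfaceAfter {d : ℕ} {Ωf Γ : Set (Vec d)} (lam Δt : ℝ)
    (U : FluidHistory Ωf Γ) (u : ℕ → FluidHistory Ωf Γ) : ℕ → ℝ
  | 0 => 0
  | n + 1 => interfaceError lam (n * Δt) ((n + 1 : ℕ) * Δt) (U - u (n + 1))

/-! ### Error recursion of the splitting method -/

section Splitting

variable {d : ℕ} {Ωf Ωs Γ : Set (Vec d)} {ρf ρs μ L₁ L₂ lam T Δt : ℝ} {N : ℕ}
  {U : FluidHistory Ωf Γ} {S : SolidHistory Ωs Γ} {u : ℕ → FluidHistory Ωf Γ}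
  {η : ℕ → SolidHistory Ωs Γ}

theorem step_subset (hΔ : 0 < Δt) (hT : T = N * Δt) {n : ℕ} (hn : n < N) :
    Icc (n * Δt) ((n + 1 : ℕ) * Δt) ⊆ Icc 0 T := by
  refine Icc_subset_Icc (by positivity) ?_
  rw [hT]
  gcongr
  exact hn

theorem lagged_errors_le (hΔ : 0 < Δt) (hl : 0 < lam) (hT : T = N * Δt)
    (hUS : IsCoupledSolution ρf ρs μ L₁ L₂ T U S)
    (h : IsSplittingSolution ρf ρs μ L₁ L₂ lam Δt N U S u η) {n : ℕ} (hn : n < N) :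
    Δt * (lam / 2 * ‖lagged Δt 0 (fun m => (U - u m).velTrace) n‖ ^ 2
      + 1 / (2 * lam) * ‖lagged Δt 0 (fun m => (U - u m).normalStress) n‖ ^ 2)
      ≤ interfaceAfter lam Δt U u n := by
  cases n with
  | zero => simp [lagged, interfaceAfter]
  | succ n =>
    have hn' : n < N := by omega
    have hs := step_subset hΔ hT hn'
    have h1 := norm_lagged_sq_le hΔ 0 (fun m => (U - u m).velTrace) n
      ((hUS.fluid.velTrace_L2.mono hs).sub (h.fluid n hn').velTrace_L2)
    have h2 := norm_lagged_sq_le hΔ 0 (fun m => (U - u m).normalStress) n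
      ((hUS.fluid.normalStress_L2.mono hs).sub (h.fluid n hn').normalStress_L2)
    have h3 := mul_le_mul_of_nonneg_left h1 (by positivity : 0 ≤ lam / 2)
    have h4 := mul_le_mul_of_nonneg_left h2 (by positivity : 0 ≤ 1 / (2 * lam))
    rw [interfaceAfter, interfaceError]
    linarith

/-- Velocities and displacements are handed over between steps, but the elastic energy needs
gradients; these agree because a displacement determines its gradient. -/
theorem energyError_start (hΩs : IsLipschitzDomain Ωs) (hΔ : 0 < Δt) (hT : T = N * Δt)
    (hUS : IsCoupledSolution ρf ρs μ L₁ L₂ T U S)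
    (h : IsSplittingSolution ρf ρs μ L₁ L₂ lam Δt N U S u η) {n : ℕ} (hn : n < N) :
    energyError ρf ρs L₁ L₂ (U - u (n + 1)) (S - η (n + 1)) (n * Δt)
      = energyAfter ρf ρs L₁ L₂ Δt U S u η n := by
  have hmem : ∀ k < N, ∀ t ∈ Icc (k * Δt) ((k + 1 : ℕ) * Δt), _ := fun k hk =>
    (h.solid k hk).mem_energySpace
  have hle : ∀ k : ℕ, (k * Δt : ℝ) ≤ (k + 1 : ℕ) * Δt := fun k => by push_cast; linarith
  cases n with
  | zero =>
    have ht : ((0 : ℕ) * Δt : ℝ) = 0 := by simp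
    have hg : (η 1).grad 0 = S.grad 0 := by
      refine energySpace_grad_unique hΩs (hmem 0 hn 0 ?_)
        (hUS.solid.mem_energySpace 0 ?_) (h.disp_initial hn)
      · exact ⟨ht.le, ht ▸ hle 0⟩
      · exact step_subset hΔ hT hn ⟨ht.le, ht ▸ hle 0⟩
    rw [ht, energyAfter]
    refine energyError_eq_zero ?_ ?_ ?_
    · exact sub_eq_zero.2 (h.fluidVel_initial hn).symm
    · exact sub_eq_zero.2 (h.solidVel_initial hn).symm
    · exact sub_eq_zero.2 hg.symm
  | succ n =>
    have hn' : n < N := by omega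
    have h1 : 1 ≤ n + 1 := by omega
    have hg : (η (n + 1 + 1)).grad ((n + 1 : ℕ) * Δt) = (η (n + 1)).grad ((n + 1 : ℕ) * Δt) :=
      energySpace_grad_unique hΩs (hmem (n + 1) hn _ ⟨le_rfl, hle (n + 1)⟩)
        (hmem n hn' _ ⟨hle n, le_rfl⟩) (h.disp_continue (n + 1) h1 hn)
    rw [energyAfter]
    refine energyError_congr ?_ ?_ ?_
    · exact congrArg (U.vel _ - ·) (h.fluidVel_continue (n + 1) h1 hn)
    · exact congrArg (S.vel _ - ·) (h.solidVel_continue (n + 1) h1 hn)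
    · exact congrArg (S.grad _ - ·) hg

/-- Young's weight is 1/N. In `2 * Δt ^ 2` one factor Δt is the length of the step, and 2Δt comes
from the lag error. -/
theorem splitting_step (hΩs : IsLipschitzDomain Ωs) (hN : 1 ≤ N) (hΔ : 0 < Δt) (hl : 0 < lam)
    (hT : T = N * Δt) (hUS : IsCoupledSolution ρf ρs μ L₁ L₂ T U S)
    {dU dσ : ℝ → L2Surf Γ} (hU : HasTimeDeriv 0 T U.velTrace dU) (hdU : L2Time 0 T dU)
    (hσ : HasTimeDeriv 0 T U.normalStress dσ) (hdσ : L2Time 0 T dσ)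
    (h : IsSplittingSolution ρf ρs μ L₁ L₂ lam Δt N U S u η) {n : ℕ} (hn : n < N) :
    energyAfter ρf ρs L₁ L₂ Δt U S u η (n + 1)
      + dissipationError μ lam (n * Δt) ((n + 1 : ℕ) * Δt) (U - u (n + 1)) (S - η (n + 1))
          (lagged Δt 0 (fun m => (U - u m).velTrace) n)
      + interfaceAfter lam Δt U u (n + 1)
      ≤ energyAfter ρf ρs L₁ L₂ Δt U S u η n
        + (1 + 1 / (N : ℝ)) * interfaceAfter lam Δt U u n
        + (1 + (N : ℝ)) * (2 * Δt ^ 2) *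
          (lam * (∫ s in ((n - 1 : ℕ) * Δt : ℝ)..((n + 1 : ℕ) * Δt : ℝ), ‖dU s‖ ^ 2)
            + 1 / lam * ∫ s in ((n - 1 : ℕ) * Δt : ℝ)..((n + 1 : ℕ) * Δt : ℝ), ‖dσ s‖ ^ 2) := by
  have hN0 : (0 : ℝ) < N := by exact_mod_cast hN
  have hs := step_subset hΔ hT hn
  have hab : (n * Δt : ℝ) < (n + 1 : ℕ) * Δt := by push_cast; linarith
  have hcT : ((n + 1 : ℕ) * Δt : ℝ) ≤ T := (hs ⟨hab.le, le_rfl⟩).2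
  have he := (hUS.fluid.isWeakStokes.mono hs).sub (h.fluid n hn).isWeakStokes
  have hz := (hUS.solid.isWeakElastic.mono hs).sub (h.solid n hn).isWeakElastic
  have hii : ∀ {f : ℝ → L2Surf Γ} {k : ℕ}, L2Time (k * Δt) ((k + 1 : ℕ) * Δt) f →
      IntervalIntegrable f volume (k * Δt) ((k + 1 : ℕ) * Δt) := by
    intro f k hf
    have hk : (k * Δt : ℝ) ≤ (k + 1 : ℕ) * Δt := by push_cast; linarith
    exact intervalIntegrable_of_integrableOn_Icc hf.integrableOn ⟨le_rfl, hk⟩ ⟨hk, le_rfl⟩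
  have hβ : lagged Δt 0 (fun m => (U - u m).velTrace) n
      = lagged Δt (U.velTrace 0) (fun _ => U.velTrace) n
        - lagged Δt (U.velTrace 0) (fun m => (u m).velTrace) n :=
    lagged_sub Δt U.velTrace (fun m => (u m).velTrace) n
      (fun k hk => hii (hUS.fluid.velTrace_L2.mono (step_subset hΔ hT (by omega))))
      (fun k hk => by subst hk; exact hii (h.fluid k (by omega)).velTrace_L2)
  have hγ : lagged Δt 0 (fun m => (U - u m).normalStress) n
      = lagged Δt (U.normalStress 0) (fun _ => U.normalStress) n
        - lagged Δt (U.normalStress 0) (fun m => (u m).normalStress) n :=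
    lagged_sub Δt U.normalStress (fun m => (u m).normalStress) n
      (fun k hk => hii (hUS.fluid.normalStress_L2.mono (step_subset hΔ hT (by omega))))
      (fun k hk => by subst hk; exact hii (h.fluid k (by omega)).normalStress_L2)
  have hv := ae_mono (Measure.restrict_mono hs le_rfl) hUS.velocity
  have hst := ae_mono (Measure.restrict_mono hs le_rfl) hUS.stress
  have step := robin_step_energy (κ := 1 / (N : ℝ)) hab hl (by positivity) he hz
    (β := lagged Δt 0 (fun m => (U - u m).velTrace) n)
    (γ := lagged Δt 0 (fun m => (U - u m).normalStress) n)
    (r := fun t => U.velTrace t - lagged Δt (U.velTrace 0) (fun _ => U.velTrace) n)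
    (q := fun t => U.normalStress t - lagged Δt (U.normalStress 0) (fun _ => U.normalStress) n)
    (by
      -- The coupling conditions put the exact solution into Robin form with its current values;
      -- replacing these by lagged values leaves exactly `r` and `q`.
      filter_upwards [h.solid_robin n hn, hv, hst] with t h1 h2 h3
      change S.normalStress t - (η (n + 1)).normalStress t = lam • (_ -
        (S.velTrace t - (η (n + 1)).velTrace t)) - _ + _ - _
      rw [hβ, hγ, ← h2, eq_sub_of_add_eq' h1, eq_neg_of_add_eq_zero_left h3]
      module)
    (by
      filter_upwards [h.fluid_robin n hn, hv] with t h1 h2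
      change U.normalStress t - (u (n + 1)).normalStress t =
        lam • ((S.velTrace t - (η (n + 1)).velTrace t) -
          (U.velTrace t - (u (n + 1)).velTrace t)) + _ + _
      rw [hγ, ← h2, eq_sub_of_add_eq' h1]
      module)
    (fun t ht => norm_sub_lagged_sq_le hΔ hU hdU hcT ht)
    (fun t ht => norm_sub_lagged_sq_le hΔ hσ hdσ hcT ht)
  have hlag := lagged_errors_le hΔ hl hT hUS h hn
  have hlag' := mul_le_mul_of_nonneg_left hlag (by positivity : 0 ≤ 1 + 1 / (N : ℝ))
  have e1 : ((n + 1 : ℕ) * Δt - n * Δt : ℝ) = Δt := by push_cast; ring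
  rw [energyError_start hΩs hΔ hT hUS h hn, e1, one_div_one_div] at step
  rw [energyAfter, interfaceAfter]
  linarith

theorem splitting_error (hΩs : IsLipschitzDomain Ωs) (hρf : 0 < ρf) (hρs : 0 < ρs) (hμ : 0 < μ)
    (hL₁ : 0 < L₁) (hL₂ : 0 ≤ L₂) (hN : 1 ≤ N) (hΔ : 0 < Δt) (hl : 0 < lam)
    (hT : T = N * Δt) (hUS : IsCoupledSolution ρf ρs μ L₁ L₂ T U S)
    {dU dσ : ℝ → L2Surf Γ} (hU : HasTimeDeriv 0 T U.velTrace dU) (hdU : L2Time 0 T dU)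
    (hσ : HasTimeDeriv 0 T U.normalStress dσ) (hdσ : L2Time 0 T dσ)
    (h : IsSplittingSolution ρf ρs μ L₁ L₂ lam Δt N U S u η) :
    energyAfter ρf ρs L₁ L₂ Δt U S u η N
      + ∑ m ∈ Finset.range N,
          dissipationError μ lam (m * Δt) ((m + 1 : ℕ) * Δt) (U - u (m + 1)) (S - η (m + 1))
            (lagged Δt 0 (fun n => (U - u n).velTrace) m)
      + interfaceAfter lam Δt U u N
      ≤ 24 * Δt * T *
        (lam * (∫ s in (0 : ℝ)..T, ‖dU s‖ ^ 2) + 1 / lam * ∫ s in (0 : ℝ)..T, ‖dσ s‖ ^ 2) := by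
  have hN0 : (1 : ℝ) ≤ N := by exact_mod_cast hN
  have hi : ∀ {f : ℝ → L2Surf Γ} (m : ℕ),
      0 ≤ ∫ s in ((m - 1 : ℕ) * Δt : ℝ)..((m + 1 : ℕ) * Δt : ℝ), ‖f s‖ ^ 2 := fun m => by
    refine intervalIntegral.integral_nonneg ?_ fun s _ => by positivity
    gcongr
    omega
  have hT0 : 0 ≤ T := by rw [hT]; positivity
  have hrec := energy_recursion_le (κ := 1 / (N : ℝ)) (N := N)
    (E := energyAfter ρf ρs L₁ L₂ Δt U S u η)
    (D := fun m => dissipationError μ lam (m * Δt) ((m + 1 : ℕ) * Δt) (U - u (m + 1))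
      (S - η (m + 1)) (lagged Δt 0 (fun n => (U - u n).velTrace) m))
    (Q := interfaceAfter lam Δt U u) (by positivity)
    (fun n => by
      cases n with
      | zero => exact le_rfl
      | succ n => exact energyError_nonneg hρf.le hρs.le hL₁.le hL₂ _ _ _)
    (fun n => dissipationError_nonneg (by push_cast; linarith) hμ.le hl.le _ _ _)
    (fun n _ => mul_nonneg (by positivity) (add_nonneg (mul_nonneg hl.le (hi n))
      (mul_nonneg (by positivity) (hi n)))) rfl rfl
    (fun n hn => splitting_step hΩs hN hΔ hl hT hUS hU hdU hσ hdσ h hn)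
  refine hrec.trans ?_
  rw [← Finset.mul_sum, Finset.sum_add_distrib, ← Finset.mul_sum, ← Finset.mul_sum]
  have s1 := sum_overlapping_integrals_le (f := fun s => ‖dU s‖ ^ 2) (fun s => by positivity) hΔ
    (N := N) (hT ▸ hdU.norm_sq_integrableOn)
  have s2 := sum_overlapping_integrals_le (f := fun s => ‖dσ s‖ ^ 2) (fun s => by positivity) hΔ
    (N := N) (hT ▸ hdσ.norm_sq_integrableOn)
  rw [← hT] at s1 s2
  have j1 : 0 ≤ ∫ s in (0 : ℝ)..T, ‖dU s‖ ^ 2 :=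
    intervalIntegral.integral_nonneg hT0 fun s _ => by positivity
  have j2 : 0 ≤ ∫ s in (0 : ℝ)..T, ‖dσ s‖ ^ 2 :=
    intervalIntegral.integral_nonneg hT0 fun s _ => by positivity
  have hB : 0 ≤ lam * ∑ m ∈ Finset.range N,
        (∫ s in ((m - 1 : ℕ) * Δt : ℝ)..((m + 1 : ℕ) * Δt : ℝ), ‖dU s‖ ^ 2)
      + 1 / lam * ∑ m ∈ Finset.range N,
        ∫ s in ((m - 1 : ℕ) * Δt : ℝ)..((m + 1 : ℕ) * Δt : ℝ), ‖dσ s‖ ^ 2 :=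
    add_nonneg (mul_nonneg hl.le (Finset.sum_nonneg fun m _ => hi m))
      (mul_nonneg (by positivity) (Finset.sum_nonneg fun m _ => hi m))
  -- Here 3 bounds `(1 + 1 / N) ^ N`, `N + N` bounds `1 + N`, and the inner factors 2 count the
  -- overlap of the intervals.
  calc _ ≤ 3 * ((N + N) * (2 * Δt ^ 2) *
        (lam * (2 * ∫ s in (0 : ℝ)..T, ‖dU s‖ ^ 2)
          + 1 / lam * (2 * ∫ s in (0 : ℝ)..T, ‖dσ s‖ ^ 2))) := by
        gcongr
        exact one_add_inv_pow_le_three hN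
    _ = _ := by rw [hT]; ring

end Splitting

theorem theorem2 :
    ∃ C : ℝ, 0 < C ∧
      ∀ (d : ℕ), 2 ≤ d →
      ∀ (Ωf Ωs : Set (Vec d)), IsLipschitzDomain Ωf → IsLipschitzDomain Ωs → Disjoint Ωf Ωs →
      ∀ (ρf ρs μ L₁ L₂ lam : ℝ), 0 < ρf → 0 < ρs → 0 < μ → 0 < L₁ → 0 ≤ L₂ → 0 < lam →
      ∀ (T Δt : ℝ) (N : ℕ), 1 ≤ N → 0 < Δt → T = N * Δt →
      ∀ (U : FluidHistory Ωf (interface Ωf Ωs)) (S : SolidHistory Ωs (interface Ωf Ωs)),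
      IsCoupledSolution ρf ρs μ L₁ L₂ T U S →
      -- the time derivatives of `U` and of `σ_F n` on the interface, in `L²(0, T; L²)`
      ∀ (dU dσ : ℝ → L2Surf (interface Ωf Ωs)),
      HasTimeDeriv 0 T U.velTrace dU → L2Time 0 T dU →
      HasTimeDeriv 0 T U.normalStress dσ → L2Time 0 T dσ →
      ∀ (u : ℕ → FluidHistory Ωf (interface Ωf Ωs)) (η : ℕ → SolidHistory Ωs (interface Ωf Ωs)),
      IsSplittingSolution ρf ρs μ L₁ L₂ lam Δt N U S u η →
      energyError ρf ρs L₁ L₂ (U - u N) (S - η N) (N * Δt)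
        -- the term `m` of the sum is that of the time step `n = m + 1`;
        -- at time `0` there is no error
        + ∑ m ∈ Finset.range N,
            dissipationError μ lam (m * Δt) ((m + 1 : ℕ) * Δt) (U - u (m + 1)) (S - η (m + 1))
              (lagged Δt 0 (fun n => (U - u n).velTrace) m)
        + interfaceError lam ((N - 1 : ℝ) * Δt) (N * Δt) (U - u N)
      ≤ C * Δt * T *
          (lam * (∫ s in (0 : ℝ)..T, ‖dU s‖ ^ 2) + 1 / lam * ∫ s in (0 : ℝ)..T, ‖dσ s‖ ^ 2) := by
  refine ⟨24, by norm_num, ?_⟩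
  intro d _ Ωf Ωs _ hΩs _ ρf ρs μ L₁ L₂ lam hρf hρs hμ hL₁ hL₂ hl T Δt N hN hΔ hT U S hUS dU dσ
    hU hdU hσ hdσ u η h
  have key := splitting_error hΩs hρf hρs hμ hL₁ hL₂ hN hΔ hl hT hUS hU hdU hσ hdσ h
  -- In successor form `energyAfter` and `interfaceAfter` unfold, and the real number `N - 1` in the
  -- statement becomes the cast of `n`.
  obtain ⟨n, rfl⟩ : ∃ n, N = n + 1 := ⟨N - 1, by omega⟩
  have e : (((n + 1 : ℕ) : ℝ) - 1) = n := by push_cast; ring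
  rw [e]
  exact key
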